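/- Let $\mathbb G=(\mathbb R^N,\circ)$, $N\ge 1$, be a stratified Lie group, i.e. a Lie group structure on $\mathbb R^N=\mathbb R^{N_1}\times\cdots\times\mathbb R^{N_k}$ such that all dilations $\delta_\lambda(x^{(1)},\dots,x^{(k)})=(\lambda x^{(1)},\dots,\lambda^k x^{(k)})$, $\lambda>0$, are automorphisms and such that the left invariant vector fields $X_1,\dots,X_{N_1}$ with $X_j(0)=\partial/\partial x^{(1)}_j$ together with their iterated commutators span $\mathbb R^N$ at every point. Put $\nabla_H=(X_1,\dots,X_{N_1})$ and $\mathcal L_p f=\nabla_H\cdot(|\nabla_H f|^{p-2}\nabla_H f)$. Let $\Omega\subset\mathbb G$ be a bounded open set, and for $1\le s\le\infty$ let $S_0^{1,s}(\Omega)$ be the completion of $C_0^\infty(\Omega)$ in the norm $\|f\|_{L^s(\Omega)}+\|\nabla_H f\|_{L^s(\Omega)}$. Let $\alpha<0$, $\beta>0$, $p,r>1$, $q>0$, and consider $$u_t-\mathcal L_p u=\alpha|u|^{q-1}u+\beta|\nabla_H u|^r\ \ (x\in\Omega,\ t>0),\qquad u=0\ \ (x\in\partial\Omega,\ t>0),\qquad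 u(0,\cdot)=u_0\ \ \text{in }\Omega, \tag{1}$$ where $u_0\in S_0^{1,\infty}(\Omega)$, $u_0\ge0$, $u_0\not\equiv0$. For $T>0$ put $Q_T=(0,T)\times\Omega$ and $m=\max\{p,q,r\}$. A weak super- (sub-) solution of (1) on $Q_T$ is a nonnegative function $u\in C([0,T)\times\overline\Omega)\cap L^m((0,T);S_0^{1,m}(\Omega))$ with $\partial_t u\in L^2((0,T);L^2(\Omega))$, $u(0,\cdot)\ge(\le)\,u_0$ almost everywhere in $\Omega$, $u\ge(\le)\,0$ on $(0,T)\times\partial\Omega$, and $$\iint_{Q_T}\partial_t u\,\phi+|\nabla_H u|^{p-2}\nabla_H u\cdot\nabla_H\phi\,dx\,dt\ \ge(\le)\ \iint_{Q_T}\left(\alpha|u|^{q-1}u+\beta|\nabla_H u|^r\right)\phi\,dx\,dt$$ for all $\phi\in C([0,T]\times\overline\Omega)\cap L^p((0,T);S_0^{1,p}(\Omega))$ with $\phi\ge0$ on $Q_T$ and $\phi=0$ on $(0,T)\times\partial\Omega$. A weak solution is both a weak super- and a weak sub-solution. The maximal existence time $T_{\max}=T_{\max}(u_0)\in[0,\infty]$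 is the supremum of all $T>0$ for which (1) has a weak solution on $Q_T$. **Theorem.** Assume that one of the following holds: * $r>\max\{p,q\}$; * $r=q>p$ and $\beta\gg|\alpha|$, i.e. $\beta\ge\Lambda|\alpha|$, where $\Lambda>0$ is a sufficiently large constant that depends only on $\mathbb G,\Omega,p,r$. Then there is $M>0$, depending only on $\mathbb G,\Omega,p,q,r,\alpha,\beta$, such that for every $u_0$ as above $$\int_\Omega u_0^{\frac{2r-p}{r-p}}\,dx>M\quad\text{implies}\quad T_{\max}(u_0)<\infty .$$ -/

import Mathlib

open MeasureTheory Filter Set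
open scoped Topology ContDiff

noncomputable section

/-- The space `ℝ^N = ℝ^{N₁} × ⋯ × ℝ^{N_{σ+1}}`, split into `σ + 1` strata. The first stratum has
index `0` and dimension `n 0 = N₁`. The norm is Euclidean and `volume` is Lebesgue measure. -/
abbrev Coord {σ : ℕ} (n : Fin (σ + 1) → ℕ) : Type :=
  EuclideanSpace ℝ (Σ k : Fin (σ + 1), Fin (n k))

/-- The dilation `δ_l (x⁽¹⁾, x⁽²⁾, …) = (l x⁽¹⁾, l² x⁽²⁾, …)`. -/
def dilation {σ : ℕ} {n : Fin (σ + 1) → ℕ} (l : ℝ) (x : Coord n) : Coord n :=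
  WithLp.toLp 2 fun i => l ^ ((i.1 : ℕ) + 1) * x i

/-- For the group law `mul` with identity `0`, the left invariant vector field `X_j` with
`X_j(0) = ∂/∂x'_j`: its value at `x` is the differential at `0` of the left translation by `x`,
applied to the `j`-th coordinate vector of the first stratum. -/
def leftField {σ : ℕ} {n : Fin (σ + 1) → ℕ} (mul : Coord n → Coord n → Coord n)
    (j : Fin (n 0)) (x : Coord n) : Coord n :=
  fderiv ℝ (fun y => mul x y) 0 (EuclideanSpace.single ⟨0, j⟩ 1)

/-- The vector fields of a family, together with all their iterated commutators. -/
inductive IsIteratedBracket {E ι : Type} [NormedAddCommGroup E] [NormedSpace ℝ E]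
    (X : ι → E → E) : (E → E) → Prop
  | base (j : ι) : IsIteratedBracket X (X j)
  | bracket (V W : E → E) : IsIteratedBracket X V → IsIteratedBracket X W →
      IsIteratedBracket X (VectorField.lieBracket ℝ V W)

/-- A (non-trivial) stratified Lie group `𝔾 = (ℝ^N, ∘)`: a Lie group law on `ℝ^N` for which all
the dilations are automorphisms and `X_1, …, X_{N₁}` satisfy Hörmander's rank condition. -/
structure StratifiedGroup {σ : ℕ} (n : Fin (σ + 1) → ℕ) where
  grp : Group (Coord n)
  contDiff_mul : ContDiff ℝ ∞ fun z : Coord n × Coord n => grp.mul z.1 z.2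
  contDiff_inv : ContDiff ℝ ∞ fun x : Coord n => grp.inv x
  dilation_mul : ∀ l : ℝ, 0 < l → ∀ x y : Coord n,
    dilation l (grp.mul x y) = grp.mul (dilation l x) (dilation l y)
  first_pos : 0 < n 0
  hormander : ∀ x : Coord n,
    Submodule.span ℝ {v | ∃ V, IsIteratedBracket (leftField grp.mul) V ∧ V x = v} = ⊤

namespace StratifiedGroup

variable {σ : ℕ} {n : Fin (σ + 1) → ℕ}

/-- The identity of a stratified group is the origin. -/
theorem one_eq_zero (G : StratifiedGroup n) : G.grp.one = (0 : Coord n) := by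
  let _ := G.grp
  have h : dilation 2 (1 : Coord n) = 1 := by
    have h1 : dilation 2 ((1 : Coord n) * 1) = dilation 2 1 * dilation 2 1 :=
      G.dilation_mul 2 two_pos 1 1
    rw [mul_one] at h1
    exact left_eq_mul.mp h1
  ext i
  have hi : (2 : ℝ) ^ ((i.1 : ℕ) + 1) * (1 : Coord n) i = (1 : Coord n) i := by
    conv_rhs => rw [← h]
    rfl
  have h2 : (1 : ℝ) < 2 ^ ((i.1 : ℕ) + 1) := one_lt_pow₀ one_lt_two (Nat.succ_ne_zero _)
  have h3 : (1 : Coord n) i = 0 := by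
    have : ((2 : ℝ) ^ ((i.1 : ℕ) + 1) - 1) * (1 : Coord n) i = 0 := by linarith
    rcases mul_eq_zero.mp this with h4 | h4
    · linarith
    · exact h4
  exact h3

/-- The horizontal gradient `∇_H φ = (X_1 φ, …, X_{N₁} φ)` of a differentiable function. -/
def hgrad (G : StratifiedGroup n) (φ : Coord n → ℝ) (x : Coord n) :
    EuclideanSpace ℝ (Fin (n 0)) :=
  WithLp.toLp 2 fun j => fderiv ℝ φ x (leftField G.grp.mul j x)

/-- `f ∈ S₀^{1,s}(Ω)` with horizontal gradient `g`. The space `S₀^{1,s}(Ω)` is the completion of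
`C₀^∞(Ω)` in the norm given by the `L^s(Ω)` norms of the function and of its horizontal
gradient (`s = ⊤`: essential supremum norms); `(f, g)` is the limit of some `(φ_k, ∇_H φ_k)`. -/
def IsSobolevZero (G : StratifiedGroup n) (Ω : Set (Coord n)) (s : ENNReal)
    (f : Coord n → ℝ) (g : Coord n → EuclideanSpace ℝ (Fin (n 0))) : Prop :=
  MemLp f s (volume.restrict Ω) ∧ MemLp g s (volume.restrict Ω) ∧
  ∃ φ : ℕ → Coord n → ℝ,
    (∀ k, ContDiff ℝ ∞ (φ k) ∧ HasCompactSupport (φ k) ∧ tsupport (φ k) ⊆ Ω) ∧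
    Tendsto (fun k => eLpNorm (fun x => φ k x - f x) s (volume.restrict Ω)) atTop (𝓝 0) ∧
    Tendsto (fun k => eLpNorm (fun x => G.hgrad (φ k) x - g x) s (volume.restrict Ω))
      atTop (𝓝 0)

/-- `u ∈ L^s((0,T); S₀^{1,s}(Ω))` with horizontal gradient `g`. -/
def IsBochnerSobolevZero (G : StratifiedGroup n) (Ω : Set (Coord n)) (T : ℝ) (s : ENNReal)
    (u : ℝ → Coord n → ℝ) (g : ℝ → Coord n → EuclideanSpace ℝ (Fin (n 0))) : Prop :=
  MemLp (fun z : ℝ × Coord n => u z.1 z.2) s (volume.restrict (Ioo 0 T ×ˢ Ω)) ∧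
  MemLp (fun z : ℝ × Coord n => g z.1 z.2) s (volume.restrict (Ioo 0 T ×ˢ Ω)) ∧
  ∀ᵐ t ∂(volume.restrict (Ioo 0 T)), G.IsSobolevZero Ω s (u t) (g t)

end StratifiedGroup

/-- `w = ∂_t u` in the sense of distributions on `(0,T) × Ω`, and `w ∈ L²((0,T); L²(Ω))`. -/
def IsTimeDerivL2 {σ : ℕ} {n : Fin (σ + 1) → ℕ} (Ω : Set (Coord n)) (T : ℝ)
    (u w : ℝ → Coord n → ℝ) : Prop :=
  MemLp (fun z : ℝ × Coord n => w z.1 z.2) 2 (volume.restrict (Ioo 0 T ×ˢ Ω)) ∧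
  ∀ ψ : ℝ × Coord n → ℝ, ContDiff ℝ ∞ ψ → HasCompactSupport ψ → tsupport ψ ⊆ Ioo 0 T ×ˢ Ω →
    ∫ z in Ioo 0 T ×ˢ Ω, u z.1 z.2 * fderiv ℝ ψ z (1, 0) =
      -∫ z in Ioo 0 T ×ˢ Ω, w z.1 z.2 * ψ z

/-- Coefficients and exponents of `u_t - 𝓛_p u = α |u|^{q-1} u + β |∇_H u|^r`. -/
structure Params where
  (α β p q r : ℝ)

namespace StratifiedGroup

variable {σ : ℕ} {n : Fin (σ + 1) → ℕ}

/-- The common part of the definitions of weak super- and sub-solutions on `Q_T = (0,T) × Ω` of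
`u_t - 𝓛_p u = α |u|^{q-1} u + β |∇_H u|^r`, `u = 0` on `∂Ω`, `u(0) = u₀`, where the relation
`rel` is `≥` for super-solutions and `≤` for sub-solutions. -/
def IsWeakRel (rel : ℝ → ℝ → Prop) (G : StratifiedGroup n) (Ω : Set (Coord n)) (P : Params)
    (u₀ : Coord n → ℝ) (T : ℝ) (u : ℝ → Coord n → ℝ) : Prop :=
  (∀ t ∈ Ioo 0 T, ∀ x ∈ Ω, 0 ≤ u t x) ∧
  ContinuousOn (fun z : ℝ × Coord n => u z.1 z.2) (Ico 0 T ×ˢ closure Ω) ∧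
  (∀ᵐ x ∂(volume.restrict Ω), rel (u 0 x) (u₀ x)) ∧
  (∀ t ∈ Ioo 0 T, ∀ x ∈ frontier Ω, rel (u t x) 0) ∧
  ∃ (g : ℝ → Coord n → EuclideanSpace ℝ (Fin (n 0))) (w : ℝ → Coord n → ℝ),
    G.IsBochnerSobolevZero Ω T (ENNReal.ofReal (max P.p (max P.q P.r))) u g ∧
    IsTimeDerivL2 Ω T u w ∧
    ∀ (φ : ℝ → Coord n → ℝ) (γ : ℝ → Coord n → EuclideanSpace ℝ (Fin (n 0))),
      ContinuousOn (fun z : ℝ × Coord n => φ z.1 z.2) (Icc 0 T ×ˢ closure Ω) →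
      G.IsBochnerSobolevZero Ω T (ENNReal.ofReal P.p) φ γ →
      (∀ t ∈ Ioo 0 T, ∀ x ∈ Ω, 0 ≤ φ t x) →
      (∀ t ∈ Ioo 0 T, ∀ x ∈ frontier Ω, φ t x = 0) →
      rel
        (∫ z in Ioo 0 T ×ˢ Ω, (w z.1 z.2 * φ z.1 z.2 +
          ‖g z.1 z.2‖ ^ (P.p - 2) * inner ℝ (g z.1 z.2) (γ z.1 z.2)))
        (∫ z in Ioo 0 T ×ˢ Ω, (P.α * (|u z.1 z.2| ^ (P.q - 1) * u z.1 z.2) +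
          P.β * ‖g z.1 z.2‖ ^ P.r) * φ z.1 z.2)

/-- A weak solution on `Q_T` is both a weak super-solution and a weak sub-solution. -/
def IsWeakSolution (G : StratifiedGroup n) (Ω : Set (Coord n)) (P : Params)
    (u₀ : Coord n → ℝ) (T : ℝ) (u : ℝ → Coord n → ℝ) : Prop :=
  IsWeakRel (· ≥ ·) G Ω P u₀ T u ∧ IsWeakRel (· ≤ ·) G Ω P u₀ T u

/-- `T_max`: the supremum of all `T > 0` such that a weak solution exists on `Q_T`. -/
def maxExistenceTime (G : StratifiedGroup n) (Ω : Set (Coord n)) (P : Params)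
    (u₀ : Coord n → ℝ) : ENNReal :=
  sSup {τ | ∃ T : ℝ, 0 < T ∧ τ = ENNReal.ofReal T ∧ ∃ u, G.IsWeakSolution Ω P u₀ T u}

/-- Admissible initial data: `u₀ ∈ S₀^{1,∞}(Ω)`, `u₀ ≥ 0`, `u₀ ≢ 0`. -/
def IsInitialDatum (G : StratifiedGroup n) (Ω : Set (Coord n)) (u₀ : Coord n → ℝ) : Prop :=
  (∃ g, G.IsSobolevZero Ω ⊤ u₀ g) ∧ (∀ᵐ x ∂(volume.restrict Ω), 0 ≤ u₀ x) ∧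
    ¬ ∀ᵐ x ∂(volume.restrict Ω), u₀ x = 0

end StratifiedGroup

end

/-! The proof is a nonlinear energy argument. Put `a = r / (r - p)` and `s = a + 1 = (2r - p) / (r -
p)`. Testing the equation with `u ^ a` gives, for `y(t) = ∫ u(t)^s`, `y' / s = -a ∫ |∇u|^p u^(a-1) +
α ∫ u^(q+a) + β ∫ |∇u|^r u^a`. The exponent `a` is the one for which `|∇u|^p u^(a-1) = (|∇u|^r
u^a)^(p/r)`, so Young's inequality absorbs the diffusion term into the gradient source up to a
constant.

The absorption term is controlled by the weighted Poincaré inequality `∫ u^(r+a) ≤ C ∫ |∇u|^r u^a`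
(`IsSobolevZero.integral_rpow_le`): if `q < r` by Young again, if `q = r` by taking `β` large
against `|α|`. By Hölder, the remaining part of the source dominates a multiple of `y^κ` with `κ =
(r + a) / s`, and `κ > 1` because `r > 1`. Hence `y' ≥ c y^κ - C`, and a large `y(0)` bounds the
life span (`le_of_superlinear`).

The Poincaré inequality rests on `∫ φ = -∫ x_j X_j φ` for a coordinate `x_j` of the first stratum:
homogeneity under dilations forces `X_j x_j = 1` and makes `X_j` divergence free. The formula is
applied to `φ = u^(r+a)` on the bounded set `Ω`.

Two points of rigour remain. Powers of `u` are admissible test functions only after a cutoff away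
from `t = T`, where `u` is bounded (`isBochnerSobolevZero_timeCutoff_mul_rpow`). The identity for
`y'` has to be derived from a distributional time derivative (`IsTimeDerivL2.integral_rpow_sub`). -/

noncomputable section

/-! ### Homogeneity of the left invariant fields and integration by parts. -/

section LeftFields

variable {σ : ℕ} {n : Fin (σ + 1) → ℕ}

/-- The dilation as a continuous linear map. -/
def dilationL (l : ℝ) : Coord n →L[ℝ] Coord n :=
  LinearMap.toContinuousLinearMap
    { toFun := dilation l
      map_add' := fun x y => by
        ext i
        simp [dilation, mul_add]
      map_smul' := fun c x => by
        ext i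
        simp [dilation]
        ring }

theorem dilationL_apply (l : ℝ) (x : Coord n) : dilationL l x = dilation l x := rfl

theorem dilation_apply (l : ℝ) (x : Coord n) (i : Σ k : Fin (σ + 1), Fin (n k)) :
    dilation l x i = l ^ ((i.1 : ℕ) + 1) * x i := rfl

theorem dilation_single (l : ℝ) (i : Σ k : Fin (σ + 1), Fin (n k)) :
    dilation l (EuclideanSpace.single i (1 : ℝ)) =
      l ^ ((i.1 : ℕ) + 1) • EuclideanSpace.single i (1 : ℝ) := by
  ext m
  by_cases h : m = i
  · subst h; simp [dilation_apply]
  · simp [dilation_apply, h]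

theorem continuous_dilation_left (x : Coord n) : Continuous fun l : ℝ => dilation l x := by
  refine (PiLp.continuous_toLp 2 _).comp (continuous_pi fun i => ?_)
  fun_prop

theorem dilation_zero_left (x : Coord n) : dilation 0 x = 0 := by
  ext i
  simp [dilation_apply]

namespace StratifiedGroup

variable (G : StratifiedGroup n)

theorem contDiff_mul_left (x : Coord n) : ContDiff ℝ ∞ fun y => G.grp.mul x y :=
  G.contDiff_mul.comp (contDiff_const.prodMk contDiff_id)

theorem contDiff_leftField (j : Fin (n 0)) : ContDiff ℝ ∞ (leftField G.grp.mul j) := by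
  unfold leftField
  exact ContDiff.fderiv_apply (n := ∞) (m := ∞) (f := fun x y => G.grp.mul x y)
    G.contDiff_mul contDiff_const contDiff_const (by simp)

/-- Differentiate `δ_l (x ∘ y) = δ_l x ∘ δ_l y` at `y = 0` along the `j`-th first-stratum direction,
on which `δ_l` acts as multiplication by `l`. -/
theorem dilation_leftField {l : ℝ} (hl : 0 < l) (j : Fin (n 0)) (x : Coord n) :
    dilation l (leftField G.grp.mul j x) = l • leftField G.grp.mul j (dilation l x) := by
  have hd : ∀ z, DifferentiableAt ℝ (fun y => G.grp.mul z y) 0 := fun z =>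
    ((G.contDiff_mul_left z).differentiable (by simp)).differentiableAt
  have e1 : HasFDerivAt (fun y => dilationL l (G.grp.mul x y))
      ((dilationL l).comp (fderiv ℝ (fun y => G.grp.mul x y) 0)) 0 :=
    (dilationL l).hasFDerivAt.comp 0 (hd x).hasFDerivAt
  have e2 : HasFDerivAt (fun y => G.grp.mul (dilation l x) (dilationL l y))
      ((fderiv ℝ (fun y => G.grp.mul (dilation l x) y) 0).comp (dilationL l)) 0 := by
    have h := (hd (dilation l x)).hasFDerivAt
    have h0 : dilationL l (0 : Coord n) = 0 := map_zero _
    rw [← h0] at h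
    have := h.comp (0 : Coord n) (dilationL l).hasFDerivAt
    rwa [h0] at this
  have e3 : (fun y => dilationL l (G.grp.mul x y)) =
      fun y => G.grp.mul (dilation l x) (dilationL l y) :=
    funext fun y => G.dilation_mul l hl x y
  rw [← e3] at e2
  have e4 := congrArg (fun A : Coord n →L[ℝ] Coord n => A (EuclideanSpace.single ⟨0, j⟩ 1))
    (e1.unique e2)
  simp only [ContinuousLinearMap.comp_apply, dilationL_apply, dilation_single, map_smul] at e4
  simpa [leftField] using e4

theorem leftField_zero (j : Fin (n 0)) :
    leftField G.grp.mul j 0 = EuclideanSpace.single ⟨0, j⟩ 1 := by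
  have h : (fun y => G.grp.mul 0 y) = fun y => y := by
    funext y
    have h1 : G.grp.mul G.grp.one y = y := G.grp.one_mul y
    rwa [G.one_eq_zero] at h1
  simp [leftField, h]

theorem leftField_dilation_apply {l : ℝ} (hl : 0 < l) (j : Fin (n 0)) (x : Coord n)
    (i : Σ k : Fin (σ + 1), Fin (n k)) :
    leftField G.grp.mul j (dilation l x) i = l ^ (i.1 : ℕ) * leftField G.grp.mul j x i := by
  have h := congrArg (fun z : Coord n => z i) (G.dilation_leftField hl j x)
  simp only [dilation_apply, PiLp.smul_apply, smul_eq_mul, pow_succ] at h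
  have : l * leftField G.grp.mul j (dilation l x) i =
      l * (l ^ (i.1 : ℕ) * leftField G.grp.mul j x i) := by
    rw [← h]; ring
  exact mul_left_cancel₀ hl.ne' this

/-- This coefficient is homogeneous of degree `0`, so it is constant along `l ↦ δ_l x`; letting `l →
0` gives its value at the identity. -/
theorem leftField_apply_self (j : Fin (n 0)) (x : Coord n) :
    leftField G.grp.mul j x ⟨0, j⟩ = 1 := by
  have hc : Continuous fun l : ℝ => leftField G.grp.mul j (dilation l x) ⟨0, j⟩ :=
    (EuclideanSpace.proj ⟨0, j⟩ : Coord n →L[ℝ] ℝ).continuous.comp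
      ((G.contDiff_leftField j).continuous.comp (continuous_dilation_left x))
  have h1 := (hc.tendsto 0).mono_left (nhdsWithin_le_nhds (s := Ioi 0))
  rw [dilation_zero_left, G.leftField_zero] at h1
  have h2 : Tendsto (fun l : ℝ => leftField G.grp.mul j (dilation l x) ⟨0, j⟩) (𝓝[>] 0)
      (𝓝 (leftField G.grp.mul j x ⟨0, j⟩)) := by
    refine tendsto_const_nhds.congr' ?_
    filter_upwards [self_mem_nhdsWithin] with l hl
    rw [G.leftField_dilation_apply hl]
    simp
  have := tendsto_nhds_unique h2 h1
  simpa using this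

theorem contDiff_leftField_apply (j : Fin (n 0)) (i : Σ k : Fin (σ + 1), Fin (n k)) :
    ContDiff ℝ ∞ fun x => leftField G.grp.mul j x i :=
  (EuclideanSpace.proj i : Coord n →L[ℝ] ℝ).contDiff.comp (G.contDiff_leftField j)

/-- The `i`-th coordinate of a left invariant field does not depend on the `i`-th variable. -/
theorem fderiv_leftField_apply_single (j : Fin (n 0)) (i : Σ k : Fin (σ + 1), Fin (n k))
    (x : Coord n) :
    fderiv ℝ (fun x => leftField G.grp.mul j x i) x (EuclideanSpace.single i 1) = 0 := by
  set a : Coord n → ℝ := fun x => leftField G.grp.mul j x i with ha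
  have hs : ContDiff ℝ ∞ a := G.contDiff_leftField_apply j i
  have hd : Differentiable ℝ a := hs.differentiable (by simp)
  -- The coefficient has degree `i.1` and the variable has weight `i.1 + 1`, so the derivative is
  -- homogeneous of degree `-1`. Being continuous at the origin, it must vanish, as `l → 0` shows.
  have key : ∀ l : ℝ, 0 < l → fderiv ℝ a x (EuclideanSpace.single i 1) =
      l * fderiv ℝ a (dilation l x) (EuclideanSpace.single i 1) := by
    intro l hl
    have e1 : HasFDerivAt (fun y => a (dilationL l y))
        ((fderiv ℝ a (dilation l x)).comp (dilationL l)) x :=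
      (hd (dilation l x)).hasFDerivAt.comp x (dilationL l).hasFDerivAt
    have e2 : HasFDerivAt (fun y => l ^ (i.1 : ℕ) * a y) (l ^ (i.1 : ℕ) • fderiv ℝ a x) x :=
      (hd x).hasFDerivAt.const_mul _
    have e3 : (fun y => a (dilationL l y)) = fun y => l ^ (i.1 : ℕ) * a y :=
      funext fun y => G.leftField_dilation_apply hl j y i
    rw [e3] at e1
    have e4 := congrArg (fun A : Coord n →L[ℝ] ℝ => A (EuclideanSpace.single i 1))
      (e1.unique e2)
    simp only [ContinuousLinearMap.comp_apply, dilationL_apply, dilation_single, map_smul,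
      smul_eq_mul, smul_apply, pow_succ] at e4
    have hp : l ^ (i.1 : ℕ) ≠ 0 := (pow_pos hl _).ne'
    refine mul_left_cancel₀ hp ?_
    rw [← e4]; ring
  have hc : Continuous fun l : ℝ => l * fderiv ℝ a (dilation l x) (EuclideanSpace.single i 1) :=
    continuous_id.mul (((hs.continuous_fderiv (by simp)).comp
      (continuous_dilation_left x)).clm_apply continuous_const)
  have h1 := (hc.tendsto 0).mono_left (nhdsWithin_le_nhds (s := Ioi 0))
  have h2 : Tendsto (fun l : ℝ => l * fderiv ℝ a (dilation l x) (EuclideanSpace.single i 1))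
      (𝓝[>] 0) (𝓝 (fderiv ℝ a x (EuclideanSpace.single i 1))) := by
    refine tendsto_const_nhds.congr' ?_
    filter_upwards [self_mem_nhdsWithin] with l hl
    exact key l hl
  simpa using tendsto_nhds_unique h2 h1

/-- Integration by parts against a first-stratum coordinate: `∫ φ = -∫ x_j X_j φ`. -/
theorem integral_eq_neg_integral_coord_mul (j : Fin (n 0)) {φ : Coord n → ℝ}
    (hφ : ContDiff ℝ ∞ φ) (hc : HasCompactSupport φ) :
    ∫ x, φ x = -∫ x, x ⟨0, j⟩ * fderiv ℝ φ x (leftField G.grp.mul j x) := by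
  set e : (Σ k : Fin (σ + 1), Fin (n k)) := ⟨0, j⟩ with he
  have hd : Differentiable ℝ φ := hφ.differentiable (by simp)
  have hcoord : ContDiff ℝ ∞ fun x : Coord n => x e :=
    (EuclideanSpace.proj e : Coord n →L[ℝ] ℝ).contDiff
  -- The coefficients of the field `x_j X_j`. Only the `e`-th one contributes to its divergence, and
  -- it contributes `1`.
  let b : (Σ k : Fin (σ + 1), Fin (n k)) → Coord n → ℝ :=
    fun i x => x e * leftField G.grp.mul j x i
  have hb : ∀ i, ContDiff ℝ ∞ (b i) := fun i => hcoord.mul (G.contDiff_leftField_apply j i)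
  have hbd : ∀ i x, fderiv ℝ (b i) x (EuclideanSpace.single i 1) = if i = e then 1 else 0 := by
    intro i x
    have h1 : HasFDerivAt (b i) (x e • fderiv ℝ (fun x => leftField G.grp.mul j x i) x +
        leftField G.grp.mul j x i • (EuclideanSpace.proj e : Coord n →L[ℝ] ℝ)) x :=
      (EuclideanSpace.proj e : Coord n →L[ℝ] ℝ).hasFDerivAt.mul
        (((G.contDiff_leftField_apply j i).differentiable (by simp)) x).hasFDerivAt
    rw [h1.fderiv]
    simp only [add_apply, smul_apply, G.fderiv_leftField_apply_single, smul_eq_mul]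
    split_ifs with h
    · subst h
      simp [he, G.leftField_apply_self]
    · simp [Ne.symm h]
  have hsum : ∀ x, x e * fderiv ℝ φ x (leftField G.grp.mul j x) =
      ∑ i, b i x * fderiv ℝ φ x (EuclideanSpace.single i 1) := by
    intro x
    have h1 : leftField G.grp.mul j x = ∑ i, leftField G.grp.mul j x i •
        (EuclideanSpace.single i 1 : Coord n) := by
      ext m
      simp [Finset.sum_apply, Pi.single_apply]
    conv_lhs => rw [h1]
    simp only [map_sum, map_smul, smul_eq_mul, Finset.mul_sum, b, mul_assoc]
  have hfc : ∀ i, Continuous fun x => fderiv ℝ φ x (EuclideanSpace.single i 1) := fun i =>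
    (hφ.continuous_fderiv (by simp)).clm_apply continuous_const
  have hfs : ∀ i, HasCompactSupport fun x => fderiv ℝ φ x (EuclideanSpace.single i 1) :=
    fun i => hc.fderiv_apply (𝕜 := ℝ) _
  have hint : ∀ i, Integrable fun x => b i x * fderiv ℝ φ x (EuclideanSpace.single i 1) :=
    fun i => ((hb i).continuous.mul (hfc i)).integrable_of_hasCompactSupport (hfs i).mul_left
  have hparts : ∀ i, ∫ x, b i x * fderiv ℝ φ x (EuclideanSpace.single i 1) =
      -∫ x, (if i = e then 1 else 0) * φ x := by
    intro i
    have h := integral_mul_fderiv_eq_neg_fderiv_mul_of_integrable (μ := volume) (f := b i)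
      (g := φ) (v := EuclideanSpace.single i 1)
      ((by fun_prop : Continuous _).integrable_of_hasCompactSupport hc.mul_left |>.congr
        (f := fun x => (if i = e then (1 : ℝ) else 0) * φ x)
        (ae_of_all _ fun x => by simp only [hbd])) (hint i)
      (((hb i).continuous.mul hφ.continuous).integrable_of_hasCompactSupport hc.mul_left)
      (fun x _ => (hb i).differentiable (by simp) x) (fun x _ => hd x)
    rw [h]
    simp only [hbd]
  simp only [hsum]
  rw [integral_finsetSum _ fun i _ => hint i]
  simp only [hparts, Finset.sum_neg_distrib, neg_neg]
  rw [Finset.sum_eq_single e]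
  · simp
  · intro i _ hi
    simp [hi]
  · simp

end StratifiedGroup

end LeftFields

/-! ### Two criteria for convergence to zero in `L^s`. -/

section LpConvergence

variable {α E F : Type*} {m0 : MeasurableSpace α} {μ : Measure α} [NormedAddCommGroup E]
  [NormedAddCommGroup F] {s : ENNReal}

theorem tendsto_eLpNorm_zero_of_dominated (hs0 : s ≠ 0) (hs : s ≠ ⊤) {f : ℕ → α → E} {b : α → F}
    (hf : ∀ k, AEStronglyMeasurable (f k) μ) (hb : MemLp b s μ)
    (hfb : ∀ k, ∀ᵐ x ∂μ, ‖f k x‖ ≤ ‖b x‖)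
    (hlim : ∀ᵐ x ∂μ, Tendsto (fun k => f k x) atTop (𝓝 0)) :
    Tendsto (fun k => eLpNorm (f k) s μ) atTop (𝓝 0) := by
  have hpos : 0 < s.toReal := ENNReal.toReal_pos hs0 hs
  simp only [eLpNorm_eq_lintegral_rpow_enorm_toReal hs0 hs]
  have h1 : Tendsto (fun k => ∫⁻ x, ‖f k x‖ₑ ^ s.toReal ∂μ) atTop (𝓝 (∫⁻ _, 0 ∂μ)) := by
    refine tendsto_lintegral_of_dominated_convergence' (fun x => ‖b x‖ₑ ^ s.toReal)
      (fun k => (hf k).enorm.pow_const _) (fun k => ?_) ?_ ?_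
    · filter_upwards [hfb k] with x hx
      exact ENNReal.rpow_le_rpow (enorm_le_iff_norm_le.mpr hx) hpos.le
    · exact (lintegral_rpow_enorm_lt_top_of_eLpNorm_lt_top hs0 hs hb.2).ne
    · filter_upwards [hlim] with x hx
      have h2 : Tendsto (fun k => ‖f k x‖ₑ) atTop (𝓝 0) := by
        simpa using hx.enorm
      have h3 := h2.ennrpow_const s.toReal
      rwa [ENNReal.zero_rpow_of_pos hpos] at h3
  rw [lintegral_zero] at h1
  have h4 := h1.ennrpow_const (1 / s.toReal)
  rwa [ENNReal.zero_rpow_of_pos (by positivity)] at h4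

/-- The bound has the shape of the error in the Sobolev chain rule: `c k` measures the smoothing of
the outer function, `B` the approximation of `f` or its gradient, `D` the change of the outer
derivative. -/
theorem tendsto_eLpNorm_zero_of_le_add {E₁ E₂ E₃ : Type*} [NormedAddCommGroup E₁]
    [NormedAddCommGroup E₂] [NormedAddCommGroup E₃] (hs : 1 ≤ s) {f : ℕ → α → E} {A : α → E₁}
    {B : ℕ → α → E₂} {D : ℕ → α → E₃} {c : ℕ → ℝ} {L : ℝ} (hL : 0 ≤ L) (hc0 : ∀ k, 0 ≤ c k)
    (hc : Tendsto c atTop (𝓝 0)) (hA : MemLp A s μ)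
    (hB : ∀ k, AEStronglyMeasurable (B k) μ) (hD : ∀ k, AEStronglyMeasurable (D k) μ)
    (hB0 : Tendsto (fun k => eLpNorm (B k) s μ) atTop (𝓝 0))
    (hD0 : Tendsto (fun k => eLpNorm (D k) s μ) atTop (𝓝 0))
    (hf : ∀ k x, ‖f k x‖ ≤ c k * ‖A x‖ + L * ‖B k x‖ + ‖D k x‖) :
    Tendsto (fun k => eLpNorm (f k) s μ) atTop (𝓝 0) := by
  have hbound : ∀ k, eLpNorm (f k) s μ ≤ ENNReal.ofReal (c k) * eLpNorm A s μ +
      ENNReal.ofReal L * eLpNorm (B k) s μ + eLpNorm (D k) s μ := by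
    intro k
    have e1 : eLpNorm (f k) s μ ≤ eLpNorm (((fun x => c k * ‖A x‖) + fun x => L * ‖B k x‖) +
        fun x => ‖D k x‖) s μ := by
      refine eLpNorm_mono_ae (ae_of_all _ fun x => (hf k x).trans ?_)
      exact le_abs_self _
    have mA : AEStronglyMeasurable (fun x => c k * ‖A x‖) μ := hA.1.norm.const_mul _
    have mB : AEStronglyMeasurable (fun x => L * ‖B k x‖) μ := (hB k).norm.const_mul _
    refine e1.trans ((eLpNorm_add_le (mA.add mB) (hD k).norm hs).trans ?_)
    refine add_le_add ((eLpNorm_add_le mA mB hs).trans (add_le_add ?_ ?_)) (eLpNorm_norm _).le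
    · refine eLpNorm_le_mul_eLpNorm_of_ae_le_mul (ae_of_all _ fun x => ?_) s
      simp [abs_of_nonneg (hc0 k)]
    · refine eLpNorm_le_mul_eLpNorm_of_ae_le_mul (ae_of_all _ fun x => ?_) s
      simp [abs_of_nonneg hL]
  refine tendsto_of_tendsto_of_tendsto_of_le_of_le tendsto_const_nhds ?_ (fun _ => zero_le)
    hbound
  have h1 : Tendsto (fun k => ENNReal.ofReal (c k) * eLpNorm A s μ) atTop (𝓝 0) := by
    have := ENNReal.Tendsto.mul_const (b := eLpNorm A s μ) (ENNReal.tendsto_ofReal hc)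
      (Or.inr hA.2.ne)
    simpa using this
  have h2 : Tendsto (fun k => ENNReal.ofReal L * eLpNorm (B k) s μ) atTop (𝓝 0) := by
    have := ENNReal.Tendsto.const_mul (a := ENNReal.ofReal L) hB0 (Or.inr ENNReal.ofReal_ne_top)
    simpa using this
  simpa using (h1.add h2).add hD0

end LpConvergence

/-! ### Chain rule in the horizontal Sobolev spaces. -/

section Sobolev

variable {σ : ℕ} {n : Fin (σ + 1) → ℕ}

theorem hasDerivAt_integral_of_continuous {H : ℝ → ℝ} (hH : Continuous H) (τ : ℝ) :
    HasDerivAt (fun τ => ∫ y in (0 : ℝ)..τ, H y) (H τ) τ :=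
  intervalIntegral.integral_hasDerivAt_right (hH.intervalIntegrable _ _)
    hH.stronglyMeasurable.stronglyMeasurableAtFilter hH.continuousAt

theorem contDiff_integral {H : ℝ → ℝ} (hH : ContDiff ℝ ∞ H) :
    ContDiff ℝ ∞ fun τ => ∫ y in (0 : ℝ)..τ, H y := by
  refine contDiff_infty_iff_deriv.mpr
    ⟨fun τ => (hasDerivAt_integral_of_continuous hH.continuous τ).differentiableAt, ?_⟩
  rwa [funext fun τ => (hasDerivAt_integral_of_continuous hH.continuous τ).deriv]

namespace StratifiedGroup

variable (G : StratifiedGroup n) {Ω : Set (Coord n)}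

theorem continuous_hgrad {φ : Coord n → ℝ} (hφ : ContDiff ℝ ∞ φ) : Continuous (G.hgrad φ) := by
  refine (PiLp.continuous_toLp 2 _).comp (continuous_pi fun j => ?_)
  exact (hφ.continuous_fderiv (by simp)).clm_apply (G.contDiff_leftField j).continuous

theorem hgrad_comp {F : ℝ → ℝ} {F' : ℝ} {φ : Coord n → ℝ} {x : Coord n}
    (hF : HasDerivAt F F' (φ x)) (hφ : DifferentiableAt ℝ φ x) :
    G.hgrad (fun y => F (φ y)) x = F' • G.hgrad φ x := by
  have h : HasFDerivAt (fun y => F (φ y)) (F' • fderiv ℝ φ x) x :=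
    hF.comp_hasFDerivAt x hφ.hasFDerivAt
  ext j
  simp [hgrad, h.fderiv]

variable {G}

theorem IsSobolevZero.congr {s : ENNReal} {f f' : Coord n → ℝ}
    {g g' : Coord n → EuclideanSpace ℝ (Fin (n 0))} (h : G.IsSobolevZero Ω s f g)
    (hf : f =ᵐ[volume.restrict Ω] f') (hg : g =ᵐ[volume.restrict Ω] g') :
    G.IsSobolevZero Ω s f' g' := by
  obtain ⟨h1, h2, φ, hφ, h3, h4⟩ := h
  refine ⟨h1.ae_eq hf, h2.ae_eq hg, φ, hφ, ?_, ?_⟩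
  · refine h3.congr fun k => eLpNorm_congr_ae ?_
    filter_upwards [hf] with x hx
    rw [hx]
  · refine h4.congr fun k => eLpNorm_congr_ae ?_
    filter_upwards [hg] with x hx
    rw [hx]

theorem IsSobolevZero.mono_exponent {s s' : ENNReal} {f : Coord n → ℝ}
    {g : Coord n → EuclideanSpace ℝ (Fin (n 0))} (h : G.IsSobolevZero Ω s' f g)
    (hΩ : volume Ω ≠ ⊤) (hs : 1 ≤ s) (hss : s ≤ s') (hs' : s' ≠ ⊤) :
    G.IsSobolevZero Ω s f g := by
  have : IsFiniteMeasure (volume.restrict Ω) :=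
    ⟨by simpa [lt_top_iff_ne_top] using hΩ⟩
  obtain ⟨h1, h2, φ, hφ, h3, h4⟩ := h
  have hC : volume.restrict Ω univ ^ (1 / s.toReal - 1 / s'.toReal) ≠ ⊤ := by
    refine ENNReal.rpow_ne_top_of_nonneg ?_ (measure_ne_top _ _)
    have hst : s ≠ ⊤ := (hss.trans_lt hs'.lt_top).ne
    have h0 : 0 < s.toReal := ENNReal.toReal_pos (by positivity) hst
    have := one_div_le_one_div_of_le h0 ((ENNReal.toReal_le_toReal hst hs').mpr hss)
    linarith
  have key : ∀ {E : Type} [NormedAddCommGroup E] {d : ℕ → Coord n → E},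
      (∀ k, AEStronglyMeasurable (d k) (volume.restrict Ω)) →
      Tendsto (fun k => eLpNorm (d k) s' (volume.restrict Ω)) atTop (𝓝 0) →
      Tendsto (fun k => eLpNorm (d k) s (volume.restrict Ω)) atTop (𝓝 0) := by
    intro E _ d hd ht
    refine tendsto_of_tendsto_of_tendsto_of_le_of_le tendsto_const_nhds ?_ (fun _ => zero_le)
      (fun k => eLpNorm_le_eLpNorm_mul_rpow_measure_univ hss (hd k))
    simpa using ENNReal.Tendsto.mul_const ht (Or.inr hC)
  exact ⟨h1.mono_exponent hss, h2.mono_exponent hss, φ, hφ,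
    key (fun k => (hφ k).1.continuous.aestronglyMeasurable.sub h1.1) h3,
    key (fun k => (G.continuous_hgrad (hφ k).1).aestronglyMeasurable.sub h2.1) h4⟩

/-- The chain rule in `S₀^{1,s}(Ω)` for the primitive of a bounded continuous function. -/
theorem IsSobolevZero.comp_integral {s : ENNReal} {f : Coord n → ℝ}
    {g : Coord n → EuclideanSpace ℝ (Fin (n 0))} (h : G.IsSobolevZero Ω s f g)
    (hs : 1 ≤ s) (hs' : s ≠ ⊤) {H : ℝ → ℝ} (hH : Continuous H) {L : ℝ} (hL : ∀ τ, |H τ| ≤ L) :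
    G.IsSobolevZero Ω s (fun x => ∫ y in (0 : ℝ)..f x, H y) (fun x => H (f x) • g x) := by
  obtain ⟨h1, h2, φ₀, hφ₀, h3₀, h4₀⟩ := h
  have hs0 : s ≠ 0 := by positivity
  have hL0 : 0 ≤ L := (abs_nonneg _).trans (hL 0)
  -- Pointwise convergence, available along a subsequence, is needed for `H (φ k x) → H (f x)`,
  -- since `H` is merely continuous.
  obtain ⟨ns, hns, hae⟩ := (tendstoInMeasure_of_tendsto_eLpNorm hs0
    (fun k => (hφ₀ k).1.continuous.aestronglyMeasurable) h1.1
    (f := φ₀) (g := f) (l := atTop) (μ := volume.restrict Ω) h3₀).exists_seq_tendsto_ae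
  set φ : ℕ → Coord n → ℝ := fun k => φ₀ (ns k) with hφdef
  have hφ : ∀ k, ContDiff ℝ ∞ (φ k) ∧ HasCompactSupport (φ k) ∧ tsupport (φ k) ⊆ Ω :=
    fun k => hφ₀ (ns k)
  have h3 := h3₀.comp hns.tendsto_atTop
  have h4 := h4₀.comp hns.tendsto_atTop
  -- Smooth uniform approximations of `H`: their primitives from `0`, composed with `φ k`, are
  -- smooth and vanish wherever `φ k` does.
  have happ : ∀ k : ℕ, ∃ K : ℝ → ℝ, ContDiff ℝ ∞ K ∧ ∀ τ, |K τ - H τ| ≤ 1 / ((k : ℝ) + 1) := by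
    intro k
    obtain ⟨K, hK, hd, -⟩ := hH.exists_contDiff_approx ⊤
      (ε := fun _ => 1 / ((k : ℝ) + 1)) continuous_const (fun _ => by positivity)
    exact ⟨K, hK, fun τ => by simpa [Real.dist_eq] using (hd τ).le⟩
  choose K hK hKH using happ
  set c : ℕ → ℝ := fun k => 1 / ((k : ℝ) + 1) with hcdef
  have hc : Tendsto c atTop (𝓝 0) := tendsto_one_div_add_atTop_nhds_zero_nat
  have hc0 : ∀ k, 0 ≤ c k := fun k => by positivity
  have hc1 : ∀ k, c k ≤ 1 := fun k => by
    rw [hcdef]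
    exact (div_le_one (by positivity)).mpr (by simp)
  have hKL : ∀ k τ, |K k τ| ≤ L + 1 := fun k τ => by
    have := abs_sub_abs_le_abs_sub (K k τ) (H τ)
    linarith [hKH k τ, hL τ, hc1 k]
  have hint : ∀ {K : ℝ → ℝ} (_ : Continuous K) {C : ℝ} (_ : ∀ τ, |K τ| ≤ C) (a b : ℝ),
      |(∫ y in (0 : ℝ)..a, K y) - ∫ y in (0 : ℝ)..b, K y| ≤ C * |a - b| := by
    intro K hK C hC a b
    rw [intervalIntegral.integral_interval_sub_left (hK.intervalIntegrable _ _)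
      (hK.intervalIntegrable _ _)]
    exact intervalIntegral.norm_integral_le_of_norm_le_const (f := K) (C := C) (a := b) (b := a)
      fun y _ => hC y
  have hint0 : ∀ {K : ℝ → ℝ} (_ : Continuous K) {C : ℝ} (_ : ∀ τ, |K τ| ≤ C) (a : ℝ),
      |∫ y in (0 : ℝ)..a, K y| ≤ C * |a| := by
    intro K hK C hC a
    simpa using hint hK hC a 0
  have hFc : Continuous fun τ => ∫ y in (0 : ℝ)..τ, H y :=
    continuous_iff_continuousAt.mpr fun τ => (hasDerivAt_integral_of_continuous hH τ).continuousAt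
  have mφ : ∀ k, AEStronglyMeasurable (fun x => φ k x - f x) (volume.restrict Ω) :=
    fun k => (hφ k).1.continuous.aestronglyMeasurable.sub h1.1
  have mg : ∀ k, AEStronglyMeasurable (fun x => G.hgrad (φ k) x - g x) (volume.restrict Ω) :=
    fun k => (G.continuous_hgrad (hφ k).1).aestronglyMeasurable.sub h2.1
  have mD : ∀ k, AEStronglyMeasurable (fun x => (H (φ k x) - H (f x)) • g x)
      (volume.restrict Ω) := fun k =>
    ((hH.comp (hφ k).1.continuous).aestronglyMeasurable.sub
      (hH.comp_aestronglyMeasurable h1.1)).smul h2.1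
  have hD0 : Tendsto (fun k => eLpNorm (fun x => (H (φ k x) - H (f x)) • g x) s
      (volume.restrict Ω)) atTop (𝓝 0) := by
    refine tendsto_eLpNorm_zero_of_dominated hs0 hs' mD (h2.const_smul (2 * L)) (fun k => ?_) ?_
    · refine ae_of_all _ fun x => ?_
      have : |H (φ k x) - H (f x)| ≤ 2 * L := by
        have := abs_sub (H (φ k x)) (H (f x))
        linarith [hL (φ k x), hL (f x)]
      simp only [Pi.smul_apply, norm_smul, Real.norm_eq_abs, abs_of_nonneg (by positivity :
        (0 : ℝ) ≤ 2 * L)]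
      exact mul_le_mul_of_nonneg_right this (norm_nonneg _)
    · filter_upwards [hae] with x hx
      have e1 : Tendsto (fun k => H (φ k x) - H (f x)) atTop (𝓝 0) := by
        simpa using ((hH.tendsto (f x)).comp hx).sub_const (H (f x))
      simpa using e1.smul_const (g x)
  refine ⟨?_, ?_, fun k x => ∫ y in (0 : ℝ)..φ k x, K k y, fun k => ⟨?_, ?_, ?_⟩, ?_, ?_⟩
  · exact h1.of_le_mul (hFc.comp_aestronglyMeasurable h1.1)
      (ae_of_all _ fun x => hint0 hH hL (f x))
  · refine h2.of_le_mul ((hH.comp_aestronglyMeasurable h1.1).smul h2.1)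
      (ae_of_all _ fun x => ?_) (c := L)
    rw [norm_smul]
    exact mul_le_mul_of_nonneg_right (hL _) (norm_nonneg _)
  · exact (contDiff_integral (hK k)).comp (hφ k).1
  · exact (hφ k).2.1.comp_left (g := fun τ => ∫ y in (0 : ℝ)..τ, K k y) (by simp)
  · exact (tsupport_comp_subset (g := fun τ => ∫ y in (0 : ℝ)..τ, K k y) (by simp) _).trans
      (hφ k).2.2
  · refine tendsto_eLpNorm_zero_of_le_add hs (L := L + 1) (c := c) (A := f)
      (B := fun k x => φ k x - f x) (D := fun _ _ => (0 : ℝ)) (by positivity) hc0 hc h1 mφ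
      (fun k => aestronglyMeasurable_const) h3 (by simp) (fun k x => ?_)
    have e1 := hint (hK k).continuous (hKL k) (φ k x) (f x)
    have e2 : |(∫ y in (0 : ℝ)..f x, K k y) - ∫ y in (0 : ℝ)..f x, H y| ≤ c k * |f x| := by
      rw [← intervalIntegral.integral_sub ((hK k).continuous.intervalIntegrable _ _)
        (hH.intervalIntegrable _ _)]
      exact hint0 ((hK k).continuous.sub hH) (hKH k) (f x)
    have e3 := abs_sub_le (∫ y in (0 : ℝ)..φ k x, K k y) (∫ y in (0 : ℝ)..f x, K k y)
      (∫ y in (0 : ℝ)..f x, H y)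
    simp only [Real.norm_eq_abs, norm_zero, add_zero]
    linarith
  · refine tendsto_eLpNorm_zero_of_le_add hs (L := L + 1) (c := c) (A := g)
      (B := fun k x => G.hgrad (φ k) x - g x) (D := fun k x => (H (φ k x) - H (f x)) • g x)
      (by positivity) hc0 hc h2 mg mD h4 hD0 (fun k x => ?_)
    rw [G.hgrad_comp (hasDerivAt_integral_of_continuous (hK k).continuous (φ k x))
      ((hφ k).1.differentiable (by simp) x)]
    have e1 : K k (φ k x) • G.hgrad (φ k) x - H (f x) • g x =
        (K k (φ k x) - H (φ k x)) • g x + K k (φ k x) • (G.hgrad (φ k) x - g x) +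
          (H (φ k x) - H (f x)) • g x := by
      simp only [sub_smul, smul_sub]
      abel
    rw [e1]
    refine (norm_add₃_le).trans (add_le_add_left (add_le_add ?_ ?_) _)
    · rw [norm_smul]
      exact mul_le_mul_of_nonneg_right (hKH k _) (norm_nonneg _)
    · rw [norm_smul]
      exact mul_le_mul_of_nonneg_right (hKL k _) (norm_nonneg _)

end StratifiedGroup

end Sobolev

/-! ### Weighted Poincaré inequality. -/

section Poincare

/-- Truncating the derivative of `y ^ a` makes it bounded, as `IsSobolevZero.comp_integral`
requires, without affecting values in `[0, K]`. -/
theorem integral_truncated_rpow {a K τ : ℝ} (ha : 1 < a) (h0 : 0 ≤ τ) (hK : τ ≤ K) :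
    ∫ y in (0 : ℝ)..τ, a * max 0 (min y K) ^ (a - 1) = τ ^ a := by
  have h1 : ∫ y in (0 : ℝ)..τ, a * max 0 (min y K) ^ (a - 1) =
      ∫ y in (0 : ℝ)..τ, a * y ^ (a - 1) := by
    refine intervalIntegral.integral_congr fun y hy => ?_
    rw [uIcc_of_le h0] at hy
    simp only [min_eq_left (hy.2.trans hK), max_eq_right hy.1]
  rw [h1, intervalIntegral.integral_const_mul, integral_rpow (Or.inl (by linarith))]
  have : (0 : ℝ) ^ a = 0 := Real.zero_rpow (by linarith)
  rw [sub_add_cancel, this]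
  field_simp
  ring

/-- A form of Young's inequality. If `R a b ≤ τ / 2`, the first term suffices; otherwise `τ < 2 R a
b`, and `r - 1` powers of `τ` are traded for powers of `b`. -/
theorem rpow_mul_le_half_rpow_add {a r R τ b : ℝ} (hr : 1 < r) (hra : r < a) (hR : 0 < R)
    (hτ : 0 ≤ τ) (hb : 0 ≤ b) :
    R * (a * τ ^ (a - 1)) * b ≤
      1 / 2 * τ ^ a + (R * a * (2 * (R * a)) ^ (r - 1)) * (b ^ r * τ ^ (a - r)) := by
  have ha : 0 < a := by linarith
  have hC : 0 ≤ (R * a * (2 * (R * a)) ^ (r - 1)) * (b ^ r * τ ^ (a - r)) := by positivity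
  rcases hτ.eq_or_lt with rfl | hτ
  · rw [Real.zero_rpow (by linarith : a - 1 ≠ 0)]
    have : 0 ≤ 1 / 2 * (0 : ℝ) ^ a := by positivity
    simp only [mul_zero, zero_mul]
    linarith
  rcases le_or_gt (R * a * b) (1 / 2 * τ) with h | h
  · have e1 : τ ^ a = τ * τ ^ (a - 1) := by
      rw [← Real.rpow_one_add' hτ.le (by linarith)]
      ring_nf
    have e2 : R * a * b * τ ^ (a - 1) ≤ 1 / 2 * τ * τ ^ (a - 1) :=
      mul_le_mul_of_nonneg_right h (by positivity)
    rw [e1]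
    linarith
  · have hb0 : 0 < b := by
      by_contra hb'
      have : b = 0 := le_antisymm (not_lt.mp hb') hb
      subst this
      simp only [mul_zero] at h
      linarith
    have e1 : τ ^ (r - 1) ≤ (2 * (R * a)) ^ (r - 1) * b ^ (r - 1) := by
      rw [← Real.mul_rpow (by positivity) hb]
      exact Real.rpow_le_rpow hτ.le (by linarith) (by linarith)
    have e2 : τ ^ (a - 1) = τ ^ (a - r) * τ ^ (r - 1) := by
      rw [← Real.rpow_add hτ]
      ring_nf
    have e3 : b ^ r = b ^ (r - 1) * b := by
      rw [← Real.rpow_add_one hb0.ne']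
      ring_nf
    have e4 : R * (a * τ ^ (a - 1)) * b ≤
        (R * a * (2 * (R * a)) ^ (r - 1)) * (b ^ r * τ ^ (a - r)) := by
      rw [e2, e3]
      calc R * (a * (τ ^ (a - r) * τ ^ (r - 1))) * b
          = R * a * τ ^ (a - r) * b * τ ^ (r - 1) := by ring
        _ ≤ R * a * τ ^ (a - r) * b * ((2 * (R * a)) ^ (r - 1) * b ^ (r - 1)) :=
            mul_le_mul_of_nonneg_left e1 (by positivity)
        _ = _ := by ring
    have : 0 ≤ 1 / 2 * τ ^ a := by positivity
    linarith

theorem integrable_mul_rpow_of_bounded {α : Type*} {m0 : MeasurableSpace α} {μ : Measure α}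
    {f h : α → ℝ} {K b : ℝ} (hf : AEStronglyMeasurable f μ)
    (hfK : ∀ᵐ x ∂μ, 0 ≤ f x ∧ f x ≤ K) (hb : 0 ≤ b) (hh : Integrable h μ) :
    Integrable (fun x => h x * f x ^ b) μ := by
  refine hh.mul_bdd (c := K ^ b)
    ((Real.continuous_rpow_const hb).comp_aestronglyMeasurable hf) ?_
  filter_upwards [hfK] with x hx
  rw [Real.norm_of_nonneg (Real.rpow_nonneg hx.1 _)]
  exact Real.rpow_le_rpow hx.1 hx.2 hb

theorem integrable_rpow_of_bounded {α : Type*} {m0 : MeasurableSpace α} {μ : Measure α}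
    [IsFiniteMeasure μ] {f : α → ℝ} {K b : ℝ} (hf : AEStronglyMeasurable f μ)
    (hfK : ∀ᵐ x ∂μ, 0 ≤ f x ∧ f x ≤ K) (hb : 0 ≤ b) :
    Integrable (fun x => f x ^ b) μ := by
  simpa using integrable_mul_rpow_of_bounded hf hfK hb (integrable_const (1 : ℝ))

namespace StratifiedGroup

variable {σ : ℕ} {n : Fin (σ + 1) → ℕ} {G : StratifiedGroup n} {Ω : Set (Coord n)}

theorem IsSobolevZero.rpow {s : ENNReal} {f : Coord n → ℝ}
    {g : Coord n → EuclideanSpace ℝ (Fin (n 0))} (h : G.IsSobolevZero Ω s f g)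
    (hs : 1 ≤ s) (hs' : s ≠ ⊤) {a K : ℝ} (ha : 1 < a)
    (hf : ∀ᵐ x ∂(volume.restrict Ω), 0 ≤ f x ∧ f x ≤ K) :
    G.IsSobolevZero Ω s (fun x => f x ^ a) (fun x => (a * f x ^ (a - 1)) • g x) := by
  have hc : Continuous fun y : ℝ => a * max 0 (min y K) ^ (a - 1) :=
    continuous_const.mul ((Real.continuous_rpow_const (by linarith)).comp (by fun_prop))
  have hb : ∀ y : ℝ, |a * max 0 (min y K) ^ (a - 1)| ≤ a * max 0 K ^ (a - 1) := by
    intro y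
    rw [abs_of_nonneg (by positivity)]
    refine mul_le_mul_of_nonneg_left ?_ (by positivity)
    exact Real.rpow_le_rpow (le_max_left _ _) (max_le_max le_rfl (min_le_right _ _))
      (by linarith)
  refine (h.comp_integral hs hs' hc hb).congr ?_ ?_
  · filter_upwards [hf] with x hx
    exact integral_truncated_rpow ha hx.1 hx.2
  · filter_upwards [hf] with x hx
    simp only [min_eq_left hx.2, max_eq_right hx.1]

theorem abs_coord_le_norm (x : Coord n) (i : Σ k : Fin (σ + 1), Fin (n k)) : |x i| ≤ ‖x‖ :=
  PiLp.norm_apply_le x i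

/-- The formula for smooth functions passes to the `L¹` limit because `|x_j| ≤ R` on `Ω`. -/
theorem IsSobolevZero.integral_eq_neg_integral {f : Coord n → ℝ}
    {g : Coord n → EuclideanSpace ℝ (Fin (n 0))} (h : G.IsSobolevZero Ω 1 f g)
    (hΩ : MeasurableSet Ω) {R : ℝ} (hR : ∀ x ∈ Ω, ‖x‖ ≤ R) (j : Fin (n 0)) :
    ∫ x in Ω, f x = -∫ x in Ω, x ⟨0, j⟩ * g x j := by
  obtain ⟨h1, h2, φ, hφ, h3, h4⟩ := h
  have hcoord : Continuous fun x : Coord n => x ⟨0, j⟩ :=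
    (EuclideanSpace.proj ⟨0, j⟩ : Coord n →L[ℝ] ℝ).continuous
  have hproj : Continuous fun v : EuclideanSpace ℝ (Fin (n 0)) => v j :=
    (EuclideanSpace.proj j : EuclideanSpace ℝ (Fin (n 0)) →L[ℝ] ℝ).continuous
  have hφi : ∀ k, Integrable (φ k) := fun k =>
    (hφ k).1.continuous.integrable_of_hasCompactSupport (hφ k).2.1
  have hgi : ∀ k, Integrable fun x => x ⟨0, j⟩ * G.hgrad (φ k) x j := by
    intro k
    refine Continuous.integrable_of_hasCompactSupport
      (hcoord.mul (hproj.comp (G.continuous_hgrad (hφ k).1))) ?_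
    refine HasCompactSupport.mul_left ?_
    refine (hφ k).2.1.mono' fun x hx => ?_
    refine tsupport_fderiv_subset ℝ (subset_tsupport _ ?_)
    intro hx'
    exact hx (by simp [hgrad, hx'])
  have hzero : ∀ k x, x ∉ Ω → φ k x = 0 := fun k x hx =>
    image_eq_zero_of_notMem_tsupport fun hx' => hx ((hφ k).2.2 hx')
  have hzero' : ∀ k x, x ∉ Ω → G.hgrad (φ k) x = 0 := by
    intro k x hx
    have : fderiv ℝ (φ k) x = 0 := image_eq_zero_of_notMem_tsupport fun hx' =>
      hx ((hφ k).2.2 (tsupport_fderiv_subset ℝ hx'))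
    ext i
    simp [hgrad, this]
  have hk : ∀ k, ∫ x in Ω, φ k x = -∫ x in Ω, x ⟨0, j⟩ * G.hgrad (φ k) x j := by
    intro k
    rw [setIntegral_eq_integral_of_forall_compl_eq_zero (hzero k),
      setIntegral_eq_integral_of_forall_compl_eq_zero
        (f := fun x : Coord n => x ⟨0, j⟩ * G.hgrad (φ k) x j) (fun x hx => by simp [hzero' k x hx])]
    exact G.integral_eq_neg_integral_coord_mul j (hφ k).1 (hφ k).2.1
  have t1 : Tendsto (fun k => ∫ x in Ω, φ k x) atTop (𝓝 (∫ x in Ω, f x)) :=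
    tendsto_integral_of_L1' f h1.1
      (Eventually.of_forall fun k => (hφi k).integrableOn) h3
  have t2 : Tendsto (fun k => ∫ x in Ω, x ⟨0, j⟩ * G.hgrad (φ k) x j) atTop
      (𝓝 (∫ x in Ω, x ⟨0, j⟩ * g x j)) := by
    refine tendsto_integral_of_L1' _
      (hcoord.aestronglyMeasurable.mul (hproj.comp_aestronglyMeasurable h2.1))
      (Eventually.of_forall fun k => (hgi k).integrableOn) ?_
    have hb : ∀ k, eLpNorm ((fun x : Coord n => x ⟨0, j⟩ * G.hgrad (φ k) x j) -
        fun x => x ⟨0, j⟩ * g x j) 1 (volume.restrict Ω) ≤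
        ENNReal.ofReal R * eLpNorm (fun x => G.hgrad (φ k) x - g x) 1 (volume.restrict Ω) := by
      intro k
      refine eLpNorm_le_mul_eLpNorm_of_ae_le_mul ?_ 1
      filter_upwards [ae_restrict_mem hΩ] with x hx
      have e1 : ((fun x : Coord n => x ⟨0, j⟩ * G.hgrad (φ k) x j) -
          fun x => x ⟨0, j⟩ * g x j) x = x ⟨0, j⟩ * (G.hgrad (φ k) x - g x) j := by
        simp [mul_sub]
      rw [e1, norm_mul]
      exact mul_le_mul ((abs_coord_le_norm x _).trans (hR x hx)) (PiLp.norm_apply_le _ j)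
        (norm_nonneg _) ((norm_nonneg x).trans (hR x hx))
    refine tendsto_of_tendsto_of_tendsto_of_le_of_le tendsto_const_nhds ?_ (fun _ => zero_le) hb
    simpa using ENNReal.Tendsto.const_mul h4 (Or.inr ENNReal.ofReal_ne_top)
  exact tendsto_nhds_unique t1 (by simpa only [hk] using t2.neg)

/-- A weighted Poincaré inequality in `S₀^{1,r}(Ω)` for bounded nonnegative functions. -/
theorem IsSobolevZero.integral_rpow_le {r a R K : ℝ} {f : Coord n → ℝ}
    {g : Coord n → EuclideanSpace ℝ (Fin (n 0))}
    (h : G.IsSobolevZero Ω (ENNReal.ofReal r) f g) (hΩ : MeasurableSet Ω) (hΩ' : volume Ω ≠ ⊤)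
    (hR0 : 0 < R) (hR : ∀ x ∈ Ω, ‖x‖ ≤ R) (hr : 1 < r) (hra : r < a)
    (hf : ∀ᵐ x ∂(volume.restrict Ω), 0 ≤ f x ∧ f x ≤ K) :
    ∫ x in Ω, f x ^ a ≤
      2 * (R * a * (2 * (R * a)) ^ (r - 1)) * ∫ x in Ω, ‖g x‖ ^ r * f x ^ (a - r) := by
  have : IsFiniteMeasure (volume.restrict Ω) :=
    ⟨by simpa [lt_top_iff_ne_top] using hΩ'⟩
  have hr1 : 1 ≤ ENNReal.ofReal r := by simpa using hr.le
  have i1 : Integrable (fun x => f x ^ a) (volume.restrict Ω) :=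
    integrable_rpow_of_bounded h.1.1 hf (by linarith)
  have ig : Integrable (fun x => ‖g x‖ ^ r) (volume.restrict Ω) := by
    have := h.2.1.integrable_norm_rpow (by simpa using by linarith) (by simp)
    rwa [ENNReal.toReal_ofReal (by linarith)] at this
  have i2 : Integrable (fun x => ‖g x‖ ^ r * f x ^ (a - r)) (volume.restrict Ω) :=
    integrable_mul_rpow_of_bounded h.1.1 hf (by linarith) ig
  let j : Fin (n 0) := ⟨0, G.first_pos⟩
  -- Integration by parts applied to `f ^ a`. The pointwise estimate returns half of `∫ f ^ a`,
  -- which is moved to the left and produces the factor `2`.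
  have h1 := ((h.rpow hr1 ENNReal.ofReal_ne_top (a := a) (by linarith) hf).mono_exponent hΩ' le_rfl
    hr1 ENNReal.ofReal_ne_top).integral_eq_neg_integral hΩ hR j
  set C := R * a * (2 * (R * a)) ^ (r - 1) with hC
  have h2 : -∫ x in Ω, x ⟨0, j⟩ * ((a * f x ^ (a - 1)) • g x) j ≤
      ∫ x in Ω, (1 / 2 * f x ^ a + C * (‖g x‖ ^ r * f x ^ (a - r))) := by
    refine (neg_le_abs _).trans ?_
    rw [← Real.norm_eq_abs]
    refine norm_integral_le_of_norm_le
      (g := fun x => 1 / 2 * f x ^ a + C * (‖g x‖ ^ r * f x ^ (a - r)))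
      ((i1.const_mul (1 / 2)).add (i2.const_mul C)) ?_
    filter_upwards [hf, ae_restrict_mem hΩ] with x hx hxΩ
    refine le_trans ?_ (rpow_mul_le_half_rpow_add hr hra hR0 hx.1 (norm_nonneg (g x)))
    have e0 : 0 ≤ a * f x ^ (a - 1) :=
      mul_nonneg (by linarith) (Real.rpow_nonneg hx.1 _)
    rw [norm_mul, PiLp.smul_apply, norm_smul, Real.norm_of_nonneg e0, mul_assoc R]
    exact mul_le_mul ((abs_coord_le_norm x _).trans (hR x hxΩ))
      (mul_le_mul_of_nonneg_left (PiLp.norm_apply_le _ j) e0)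
      (mul_nonneg e0 (norm_nonneg _)) hR0.le
  have h3 : ∫ x in Ω, (1 / 2 * f x ^ a + C * (‖g x‖ ^ r * f x ^ (a - r))) =
      1 / 2 * (∫ x in Ω, f x ^ a) + C * ∫ x in Ω, ‖g x‖ ^ r * f x ^ (a - r) := by
    rw [integral_add (i1.const_mul _) (i2.const_mul _), integral_const_mul, integral_const_mul]
  rw [← h1, h3] at h2
  linarith

end StratifiedGroup

end Poincare

/-! ### Inequalities of Young and Hölder. -/

section RealInequalities

theorem exists_forall_mul_rpow_le {θ A ε : ℝ} (hθ0 : 0 ≤ θ) (hθ : θ < 1) (hA : 0 ≤ A)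
    (hε : 0 < ε) : ∃ K : ℝ, 0 ≤ K ∧ ∀ X : ℝ, 0 ≤ X → A * X ^ θ ≤ ε * X + K := by
  -- For positive `A` this is the positive point where `A * X ^ θ = ε * X`; beyond it the linear
  -- term wins, before it the left side is at most its value there.
  set X₀ : ℝ := (A / ε) ^ (1 / (1 - θ)) with hX₀
  have h0 : 0 ≤ X₀ := by positivity
  refine ⟨A * X₀ ^ θ, by positivity, fun X hX => ?_⟩
  rcases le_or_gt X X₀ with h | h
  · have : X ^ θ ≤ X₀ ^ θ := Real.rpow_le_rpow hX h hθ0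
    nlinarith [mul_le_mul_of_nonneg_left this hA, mul_nonneg hε.le hX]
  · have hXp : 0 < X := h0.trans_lt h
    have e1 : A / ε ≤ X ^ (1 - θ) := by
      have : X₀ ^ (1 - θ) = A / ε := by
        rw [hX₀, ← Real.rpow_mul (by positivity), one_div_mul_cancel (by linarith),
          Real.rpow_one]
      rw [← this]
      exact Real.rpow_le_rpow h0 h.le (by linarith)
    have e2 : X ^ (1 - θ) * X ^ θ = X := by
      rw [← Real.rpow_add hXp]
      simp
    have e3 : A ≤ ε * X ^ (1 - θ) := by
      rw [div_le_iff₀ hε] at e1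
      linarith
    have e4 : A * X ^ θ ≤ ε * X ^ (1 - θ) * X ^ θ :=
      mul_le_mul_of_nonneg_right e3 (by positivity)
    have : 0 ≤ A * X₀ ^ θ := by positivity
    calc A * X ^ θ ≤ ε * (X ^ (1 - θ) * X ^ θ) := by linarith
      _ ≤ _ := by rw [e2]; linarith

/-- Hölder's inequality against the constant `1`. The `+ 1` keeps the factor positive for a null
measure, so that one can divide by it. -/
theorem rpow_integral_le {α : Type*} {m0 : MeasurableSpace α} {μ : Measure α}
    [IsFiniteMeasure μ] {f : α → ℝ} {K s κ : ℝ} (hf : AEStronglyMeasurable f μ)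
    (hfK : ∀ᵐ x ∂μ, 0 ≤ f x ∧ f x ≤ K) (hs : 0 < s) (hκ : 1 < κ) :
    (∫ x, f x ^ s ∂μ) ^ κ ≤ (μ.real univ + 1) ^ (κ - 1) * ∫ x, f x ^ (s * κ) ∂μ := by
  have hconj : κ.HolderConjugate (Real.conjExponent κ) := Real.HolderConjugate.conjExponent hκ
  have hκ0 : 0 < κ := by linarith
  have m1 : AEStronglyMeasurable (fun x => f x ^ s) μ :=
    (Real.continuous_rpow_const hs.le).comp_aestronglyMeasurable hf
  have h1 := integral_mul_le_Lp_mul_Lq_of_nonneg (μ := μ) hconj (f := fun x => f x ^ s)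
    (g := fun _ => (1 : ℝ)) (by filter_upwards [hfK] with x hx; exact Real.rpow_nonneg hx.1 _)
    (ae_of_all _ fun _ => zero_le_one)
    (MemLp.of_bound m1 (K ^ s) (by
      filter_upwards [hfK] with x hx
      rw [Real.norm_of_nonneg (Real.rpow_nonneg hx.1 _)]
      exact Real.rpow_le_rpow hx.1 hx.2 hs.le)) (memLp_const 1)
  have h2 : ∫ x, (f x ^ s) ^ κ ∂μ = ∫ x, f x ^ (s * κ) ∂μ := by
    refine integral_congr_ae ?_
    filter_upwards [hfK] with x hx
    exact (Real.rpow_mul hx.1 _ _).symm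
  simp only [mul_one, Real.one_rpow, h2, integral_const, smul_eq_mul] at h1
  have hI0 : 0 ≤ ∫ x, f x ^ s ∂μ :=
    integral_nonneg_of_ae (by filter_upwards [hfK] with x hx; exact Real.rpow_nonneg hx.1 _)
  have hI1 : 0 ≤ ∫ x, f x ^ (s * κ) ∂μ :=
    integral_nonneg_of_ae (by filter_upwards [hfK] with x hx; exact Real.rpow_nonneg hx.1 _)
  have hV : 0 ≤ μ.real univ := measureReal_nonneg
  calc (∫ x, f x ^ s ∂μ) ^ κ
      ≤ ((∫ x, f x ^ (s * κ) ∂μ) ^ (1 / κ) * μ.real univ ^ (1 / Real.conjExponent κ)) ^ κ :=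
        Real.rpow_le_rpow hI0 h1 hκ0.le
    _ = (∫ x, f x ^ (s * κ) ∂μ) * μ.real univ ^ (κ - 1) := by
        rw [Real.mul_rpow (by positivity) (by positivity), ← Real.rpow_mul hI1,
          one_div_mul_cancel hκ0.ne', Real.rpow_one, ← Real.rpow_mul hV]
        congr 2
        rw [Real.conjExponent]
        field_simp
    _ ≤ (∫ x, f x ^ (s * κ) ∂μ) * (μ.real univ + 1) ^ (κ - 1) :=
        mul_le_mul_of_nonneg_left (Real.rpow_le_rpow hV (by linarith) (by linarith)) hI1
    _ = _ := mul_comm _ _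

end RealInequalities

/-! ### Blow-up for an integrated superlinear differential inequality. -/

section BlowUp

/-- If `f` is continuous and `f' ≥ c f^κ - C` in the integrated sense with `κ > 1`, then a large
initial value bounds the length of the interval. -/
theorem sub_le_of_superlinear_of_continuous {c C κ M a b : ℝ} (hc : 0 < c) (hκ : 1 < κ)
    (hM : 0 < M) (hMC : 2 * C ≤ c * M ^ κ) (hC : 0 ≤ C) {f : ℝ → ℝ} (hf : Continuous f)
    (hab : a ≤ b) (ha : M < f a)
    (hineq : ∀ t ∈ Icc a b, ∫ τ in a..t, (c * f τ ^ κ - C) ≤ f t - f a) :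
    b - a ≤ 2 * M ^ (1 - κ) / (c * (κ - 1)) := by
  have hκ0 : 0 < κ := by linarith
  have hpow : ∀ y, M ≤ y → c / 2 * y ^ κ ≤ c * y ^ κ - C := by
    intro y hy
    have : M ^ κ ≤ y ^ κ := Real.rpow_le_rpow hM.le hy hκ0.le
    nlinarith [mul_le_mul_of_nonneg_left this hc.le]
  have hfp : Continuous fun τ => f τ ^ κ := hf.rpow_const fun _ => Or.inr hκ0.le
  -- At the first time where `f ≤ M`, the integrand has been nonnegative so far, so `f` is still at
  -- least `f a > M`.
  have hlarge : ∀ t ∈ Icc a b, M < f t := by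
    by_contra! hcon
    obtain ⟨t, ht, htM⟩ := hcon
    set S : Set ℝ := Icc a b ∩ {τ | f τ ≤ M} with hS
    have hScl : IsClosed S := isClosed_Icc.inter (isClosed_le hf continuous_const)
    have hSne : S.Nonempty := ⟨t, ht, htM⟩
    have hSb : BddBelow S := ⟨a, fun τ hτ => hτ.1.1⟩
    have hmem := hScl.csInf_mem hSne hSb
    have h1 : 0 ≤ ∫ τ in a..sInf S, (c * f τ ^ κ - C) := by
      refine intervalIntegral.integral_nonneg_of_ae_restrict hmem.1.1 ?_
      rw [← restrict_Ico_eq_restrict_Icc]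
      filter_upwards [ae_restrict_mem measurableSet_Ico] with τ hτ
      have h2 : M < f τ := by
        by_contra! h
        exact absurd (csInf_le hSb ⟨⟨hτ.1, hτ.2.le.trans hmem.1.2⟩, h⟩) (not_le.mpr hτ.2)
      have h3 := hpow (f τ) h2.le
      have : 0 ≤ c / 2 * f τ ^ κ :=
        mul_nonneg (by linarith) (Real.rpow_nonneg (hM.le.trans h2.le) _)
      simp only [Pi.zero_apply]
      linarith
    have h2 := hineq _ hmem.1
    have h3 : f (sInf S) ≤ M := hmem.2
    linarith
  -- `f` need not be differentiable; `h` is a differentiable minorant satisfying `h' = c / 2 * f ^ κ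
  -- ≥ c / 2 * h ^ κ`.
  set h : ℝ → ℝ := fun t => f a + ∫ τ in a..t, c / 2 * f τ ^ κ with hh
  have hd : ∀ t, HasDerivAt h (c / 2 * f t ^ κ) t := fun t =>
    (intervalIntegral.integral_hasDerivAt_right
      ((continuous_const.mul hfp).intervalIntegrable _ _)
      (continuous_const.mul hfp).stronglyMeasurable.stronglyMeasurableAtFilter
      (continuous_const.mul hfp).continuousAt).const_add (f a)
  have hhf : ∀ t ∈ Icc a b, h t ≤ f t := by
    intro t ht
    have h1 : ∫ τ in a..t, c / 2 * f τ ^ κ ≤ ∫ τ in a..t, (c * f τ ^ κ - C) :=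
      intervalIntegral.integral_mono_on ht.1
        ((continuous_const.mul hfp).intervalIntegrable _ _)
        (((continuous_const.mul hfp).sub continuous_const).intervalIntegrable _ _)
        fun τ hτ => hpow _ (hlarge τ ⟨hτ.1, hτ.2.trans ht.2⟩).le
    have := hineq t ht
    simp only [hh]
    linarith
  have hhM : ∀ t ∈ Icc a b, M < h t := by
    intro t ht
    have h1 : 0 ≤ ∫ τ in a..t, c / 2 * f τ ^ κ :=
      intervalIntegral.integral_nonneg ht.1 fun τ hτ => mul_nonneg (by linarith)
        (Real.rpow_nonneg (hM.le.trans (hlarge τ ⟨hτ.1, hτ.2.trans ht.2⟩).le) _)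
    simp only [hh]
    linarith
  -- Separation of variables: `w` is nonincreasing, and positivity of `h b ^ (1 - κ)` then bounds `b
  -- - a`.
  set w : ℝ → ℝ := fun t => h t ^ (1 - κ) + (κ - 1) * (c / 2) * t with hw
  have hwd : ∀ t ∈ Icc a b, HasDerivAt w (c / 2 * f t ^ κ * (1 - κ) * h t ^ (1 - κ - 1) +
      (κ - 1) * (c / 2)) t := by
    intro t ht
    have h1 := (hd t).rpow_const (p := 1 - κ) (Or.inl (hM.trans (hhM t ht)).ne')
    have h2 : HasDerivAt (fun t => (κ - 1) * (c / 2) * t) ((κ - 1) * (c / 2)) t := by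
      simpa using (hasDerivAt_id t).const_mul ((κ - 1) * (c / 2))
    exact h1.add h2
  have hanti : AntitoneOn w (Icc a b) := by
    refine antitoneOn_of_deriv_nonpos (convex_Icc a b)
      (fun t ht => (hwd t ht).continuousAt.continuousWithinAt)
      (fun t ht => ((hwd t (interior_subset ht)).differentiableAt.differentiableWithinAt))
      fun t ht => ?_
    have ht' := interior_subset ht
    rw [(hwd t ht').deriv]
    have hhp : 0 < h t := hM.trans (hhM t ht')
    have e1 : h t ^ κ ≤ f t ^ κ := Real.rpow_le_rpow hhp.le (hhf t ht') hκ0.le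
    have e2 : h t ^ κ * h t ^ (1 - κ - 1) = 1 := by
      rw [← Real.rpow_add hhp]
      simp
    have e3 : 1 ≤ f t ^ κ * h t ^ (1 - κ - 1) := by
      exact e2.symm.le.trans (mul_le_mul_of_nonneg_right e1 (by positivity))
    have e4 : 0 ≤ (κ - 1) * (c / 2) := mul_nonneg (by linarith) (by linarith)
    nlinarith [mul_le_mul_of_nonneg_left e3 e4]
  have hfin := hanti (left_mem_Icc.mpr hab) (right_mem_Icc.mpr hab) hab
  have e1 : 0 < h b ^ (1 - κ) :=
    Real.rpow_pos_of_pos (hM.trans (hhM b (right_mem_Icc.mpr hab))) _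
  have e2 : h a ^ (1 - κ) ≤ M ^ (1 - κ) :=
    Real.rpow_le_rpow_of_nonpos hM (hhM a (left_mem_Icc.mpr hab)).le (by linarith)
  simp only [hw] at hfin
  rw [le_div_iff₀ (mul_pos hc (by linarith))]
  nlinarith

/-- Version of `sub_le_of_superlinear_of_continuous` on a half-open interval. -/
theorem le_of_superlinear {c C κ M T : ℝ} (hc : 0 < c) (hκ : 1 < κ) (hM : 0 < M)
    (hMC : 2 * C ≤ c * M ^ κ) (hC : 0 ≤ C) {f : ℝ → ℝ} (hT : 0 < T)
    (hf : ContinuousOn f (Ico 0 T)) (h0 : M < f 0)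
    (hineq : ∀ t₁ t₂, 0 < t₁ → t₁ < t₂ → t₂ < T →
      ∫ τ in t₁..t₂, (c * f τ ^ κ - C) ≤ f t₂ - f t₁) :
    T ≤ 2 * M ^ (1 - κ) / (c * (κ - 1)) + 1 := by
  have hev : ∀ᶠ t in 𝓝[Ico 0 T] 0, M < f t :=
    (hf 0 ⟨le_rfl, hT⟩).eventually (lt_mem_nhds h0)
  rw [nhdsWithin_Ico_eq_nhdsGE hT] at hev
  -- The inequality is assumed only at positive times, so the argument starts at some `a < 1`; this
  -- accounts for the `+ 1` in the bound.
  obtain ⟨a, ⟨ha0, haT⟩, haM⟩ : ∃ a ∈ Ioo 0 (min T 1), M < f a := by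
    have h1 : ∀ᶠ t in 𝓝[>] (0 : ℝ), M < f t :=
      hev.filter_mono (nhdsWithin_mono _ Ioi_subset_Ici_self)
    have h2 : ∀ᶠ t in 𝓝[>] (0 : ℝ), t ∈ Ioo 0 (min T 1) :=
      Ioo_mem_nhdsGT (lt_min hT one_pos)
    obtain ⟨a, h⟩ := (h2.and h1).exists
    exact ⟨a, h.1, h.2⟩
  have hbound : ∀ b ∈ Ioo a T, b ≤ 2 * M ^ (1 - κ) / (c * (κ - 1)) + 1 := by
    intro b hb
    have hsub : Icc a b ⊆ Ico 0 T := fun t ht => ⟨ha0.le.trans ht.1, ht.2.trans_lt hb.2⟩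
    set F := IccExtend hb.1.le ((Icc a b).domRestrict f) with hF
    have hFf : ∀ t ∈ Icc a b, F t = f t := fun t ht => IccExtend_of_mem _ _ ht
    have hFc : Continuous F := (continuousOn_iff_continuous_domRestrict.mp (hf.mono hsub)).Icc_extend'
    have hmain := sub_le_of_superlinear_of_continuous hc hκ hM hMC hC hFc hb.1.le
      (by rwa [hFf a (left_mem_Icc.mpr hb.1.le)]) fun t ht => by
        rw [hFf t ht, hFf a (left_mem_Icc.mpr hb.1.le)]
        rcases ht.1.eq_or_lt with h | h
        · simp [h]
        · refine le_trans (le_of_eq ?_) (hineq a t ha0 h (ht.2.trans_lt hb.2))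
          refine intervalIntegral.integral_congr fun τ hτ => ?_
          rw [uIcc_of_le ht.1] at hτ
          simp only [hFf τ ⟨hτ.1, hτ.2.trans ht.2⟩]
    have : a < 1 := haT.trans_le (min_le_right _ _)
    linarith
  refine le_of_forall_lt_imp_le_of_dense fun t ht => ?_
  have haT' : a < T := haT.trans_le (min_le_left _ _)
  have := hbound ((max a t + T) / 2) ⟨by
    have := le_max_left a t
    have := max_lt haT' ht
    linarith, by linarith [max_lt haT' ht]⟩
  linarith [le_max_right a t, max_lt haT' ht]

end BlowUp

/-! ### Powers of absolutely continuous functions. -/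

section ChainRule

theorem AbsolutelyContinuousOnInterval.comp_of_abs_sub_le {f φ : ℝ → ℝ} {a b L : ℝ}
    (hf : AbsolutelyContinuousOnInterval f a b)
    (hφ : ∀ x ∈ uIcc a b, ∀ y ∈ uIcc a b, |φ (f x) - φ (f y)| ≤ L * |f x - f y|) :
    AbsolutelyContinuousOnInterval (fun x => φ (f x)) a b := by
  have h : Tendsto (fun E : ℕ × (ℕ → ℝ × ℝ) =>
      L * ∑ i ∈ Finset.range E.1, dist (f (E.2 i).1) (f (E.2 i).2))
      (AbsolutelyContinuousOnInterval.totalLengthFilter ⊓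
        𝓟 (AbsolutelyContinuousOnInterval.disjWithin a b)) (𝓝 0) := by
    simpa using Tendsto.const_mul L hf
  refine squeeze_zero' (Eventually.of_forall fun E => Finset.sum_nonneg fun i _ => dist_nonneg)
    ?_ h
  refine eventually_inf_principal.mpr (Eventually.of_forall fun E hE => ?_)
  rw [Finset.mul_sum]
  exact Finset.sum_le_sum fun i hi => hφ _ (hE.1 i hi).1 _ (hE.1 i hi).2

/-- The primitive `v` of `w` is absolutely continuous with values in a bounded interval `[0, K]`,
where `y ^ s` is Lipschitz. So `v ^ s` is absolutely continuous and is the integral of its almost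
everywhere derivative. -/
theorem rpow_sub_rpow_eq_integral {u w : ℝ → ℝ} {a b s : ℝ} (hab : a ≤ b) (hs : 1 < s)
    (hw : IntervalIntegrable w volume a b)
    (hu : ∀ t ∈ Icc a b, u t - u a = ∫ τ in a..t, w τ) (hu0 : ∀ t ∈ Icc a b, 0 ≤ u t) :
    u b ^ s - u a ^ s = ∫ t in a..b, s * u t ^ (s - 1) * w t := by
  set v : ℝ → ℝ := fun t => u a + ∫ τ in a..t, w τ with hv
  have huv : ∀ t ∈ Icc a b, v t = u t := fun t ht => by
    simp only [hv, ← hu t ht]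
    ring
  have hvAC : AbsolutelyContinuousOnInterval v a b := by
    have h1 := hw.absolutelyContinuousOnInterval_intervalIntegral (c := a) (by simp)
    have h2 : AbsolutelyContinuousOnInterval (fun _ : ℝ => u a) a b := by
      simpa [AbsolutelyContinuousOnInterval] using tendsto_const_nhds
    exact h2.add h1
  obtain ⟨K, hK⟩ := hvAC.exists_bound
  have hIcc : uIcc a b = Icc a b := uIcc_of_le hab
  have hv0K : ∀ t ∈ uIcc a b, v t ∈ Icc 0 K := fun t ht =>
    ⟨by rw [hIcc] at ht; rw [huv t ht]; exact hu0 t ht,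
      (le_abs_self _).trans (hK t ht)⟩
  have hφ : ∀ x ∈ Icc 0 K, ∀ y ∈ Icc 0 K, |x ^ s - y ^ s| ≤ (s * K ^ (s - 1)) * |x - y| := by
    intro x hx y hy
    refine (convex_Icc 0 K).norm_image_sub_le_of_norm_hasDerivWithin_le
      (f := fun y : ℝ => y ^ s) (f' := fun y : ℝ => s * y ^ (s - 1))
      (fun z _ => (Real.hasDerivAt_rpow_const (Or.inr hs.le)).hasDerivWithinAt)
      (fun z hz => ?_) hy hx
    rw [Real.norm_of_nonneg (mul_nonneg (by linarith) (Real.rpow_nonneg hz.1 _))]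
    exact mul_le_mul_of_nonneg_left (Real.rpow_le_rpow hz.1 hz.2 (by linarith)) (by linarith)
  have hAC : AbsolutelyContinuousOnInterval (fun t => v t ^ s) a b :=
    hvAC.comp_of_abs_sub_le (φ := fun y : ℝ => y ^ s)
      fun x hx y hy => hφ _ (hv0K x hx) _ (hv0K y hy)
  have hmain := hAC.integral_deriv_eq_sub
  simp only [huv b (right_mem_Icc.mpr hab), huv a (left_mem_Icc.mpr hab)] at hmain
  rw [← hmain]
  refine intervalIntegral.integral_congr_ae ?_
  filter_upwards [hw.ae_hasDerivAt_integral] with t ht htm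
  have htm' : t ∈ uIcc a b := uIoc_subset_uIcc htm
  have h1 : HasDerivAt v (w t) t := (ht htm' a (by simp)).const_add (u a)
  have h2 := h1.rpow_const (p := s) (Or.inr hs.le)
  rw [h2.deriv, huv t (hIcc ▸ htm')]
  ring

end ChainRule

/-! ### Smooth steps in time. -/

section TimeDerivative

/-- A smooth step from `0` (left of `c`) to `1` (right of `c + ε`). -/
def smoothStep (c ε t : ℝ) : ℝ := Real.smoothTransition ((t - c) / ε)

theorem contDiff_smoothStep (c ε : ℝ) : ContDiff ℝ ∞ (smoothStep c ε) :=
  Real.smoothTransition.contDiff.comp ((contDiff_id.sub contDiff_const).div_const _)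

theorem smoothStep_of_le {c ε t : ℝ} (hε : 0 < ε) (h : t ≤ c) : smoothStep c ε t = 0 :=
  Real.smoothTransition.zero_of_nonpos (div_nonpos_of_nonpos_of_nonneg (by linarith) hε.le)

theorem smoothStep_of_ge {c ε t : ℝ} (hε : 0 < ε) (h : c + ε ≤ t) : smoothStep c ε t = 1 :=
  Real.smoothTransition.one_of_one_le ((one_le_div hε).mpr (by linarith))

theorem monotone_smoothStep {c ε : ℝ} (hε : 0 < ε) : Monotone (smoothStep c ε) :=
  fun _ _ h => Real.smoothTransition.monotone
    (div_le_div_of_nonneg_right (sub_le_sub_right h _) hε.le)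

theorem deriv_smoothStep_of_notMem {c ε t : ℝ} (hε : 0 < ε) (h : t ∉ Ioc c (c + ε)) :
    deriv (smoothStep c ε) t = 0 := by
  have hcont : Continuous (deriv (smoothStep c ε)) :=
    (contDiff_smoothStep c ε).continuous_deriv (by simp)
  have h1 : EqOn (deriv (smoothStep c ε)) 0 (Iio c) := by
    intro y hy
    have : smoothStep c ε =ᶠ[𝓝 y] fun _ => 0 := by
      filter_upwards [Iio_mem_nhds hy] with z hz
      exact smoothStep_of_le hε (le_of_lt hz)
    simp [this.deriv_eq]
  rcases le_or_gt t c with h2 | h2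
  · have := h1.closure hcont continuous_zero
    rw [closure_Iio] at this
    exact this h2
  · have h3 : c + ε < t := by
      by_contra! h3
      exact h ⟨h2, h3⟩
    have : smoothStep c ε =ᶠ[𝓝 t] fun _ => 1 := by
      filter_upwards [Ioi_mem_nhds h3] with z hz
      exact smoothStep_of_ge hε (le_of_lt hz)
    simp [this.deriv_eq]

/-- The derivative of the step is nonnegative, has mass one and lives on `(c, c + ε]`: an
approximate identity at `c`. -/
theorem tendsto_integral_deriv_smoothStep_mul {T c : ℝ} (hc : c ∈ Ioo 0 T) {V : ℝ → ℝ}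
    (hV : ContinuousOn V (Ioo 0 T)) {ε : ℕ → ℝ} (hε : ∀ k, 0 < ε k)
    (hε0 : Tendsto ε atTop (𝓝 0)) :
    Tendsto (fun k => ∫ t in Ioo 0 T, deriv (smoothStep c (ε k)) t * V t) atTop (𝓝 (V c)) := by
  rw [Metric.tendsto_atTop]
  intro δ hδ
  have hVc : ContinuousAt V c := hV.continuousAt (Ioo_mem_nhds hc.1 hc.2)
  obtain ⟨η, hη, hball⟩ := Metric.continuousAt_iff.mp hVc (δ / 2) (by positivity)
  have hev : ∀ᶠ k in atTop, ε k < min η (T - c) :=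
    hε0.eventually (gt_mem_nhds (lt_min hη (by linarith [hc.2])))
  obtain ⟨N, hN⟩ := eventually_atTop.mp hev
  refine ⟨N, fun k hk => ?_⟩
  have hk1 := (hN k hk).trans_le (min_le_left _ _)
  have hk2 := (hN k hk).trans_le (min_le_right _ _)
  set S := smoothStep c (ε k) with hS
  have hSc : Continuous (deriv S) := (contDiff_smoothStep c (ε k)).continuous_deriv (by simp)
  have hle : c ≤ c + ε k := by linarith [hε k]
  have hsub : Icc c (c + ε k) ⊆ Ioo 0 T := fun t ht =>
    ⟨hc.1.trans_le ht.1, by linarith [ht.2]⟩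
  have e1 : ∫ t in Ioo 0 T, deriv S t * V t = ∫ t in c..(c + ε k), deriv S t * V t := by
    rw [intervalIntegral.integral_of_le hle]
    refine (setIntegral_eq_of_subset_of_forall_sdiff_eq_zero measurableSet_Ioo
      (Ioc_subset_Icc_self.trans hsub) fun t ht => ?_)
    rw [hS, deriv_smoothStep_of_notMem (hε k) ht.2, zero_mul]
  have e2 : ∫ t in c..(c + ε k), deriv S t = 1 := by
    rw [intervalIntegral.integral_deriv_eq_sub
      (fun t _ => (contDiff_smoothStep c (ε k)).differentiable (by simp) t)
      (hSc.intervalIntegrable _ _), smoothStep_of_ge (hε k) le_rfl,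
      smoothStep_of_le (hε k) le_rfl, sub_zero]
  have i1 : IntervalIntegrable (fun t => deriv S t * V t) volume c (c + ε k) := by
    refine ContinuousOn.intervalIntegrable ?_
    rw [uIcc_of_le hle]
    exact hSc.continuousOn.mul (hV.mono hsub)
  have i2 : IntervalIntegrable (fun t => deriv S t * V c) volume c (c + ε k) :=
    (hSc.mul continuous_const).intervalIntegrable _ _
  have e3 : (∫ t in Ioo 0 T, deriv S t * V t) - V c =
      ∫ t in c..(c + ε k), (deriv S t * V t - deriv S t * V c) := by
    rw [intervalIntegral.integral_sub i1 i2, intervalIntegral.integral_mul_const, e2, e1, one_mul]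
  have hS0 : ∀ t, 0 ≤ deriv S t := fun t => (monotone_smoothStep (hε k)).deriv_nonneg
  rw [Real.dist_eq, e3]
  have e4 : ‖∫ t in c..(c + ε k), (deriv S t * V t - deriv S t * V c)‖ ≤
      ∫ t in c..(c + ε k), deriv S t * (δ / 2) := by
    refine intervalIntegral.norm_integral_le_of_norm_le hle (ae_of_all _ fun t ht => ?_)
      ((hSc.mul continuous_const).intervalIntegrable _ _)
    rw [← mul_sub, norm_mul, Real.norm_of_nonneg (hS0 t)]
    refine mul_le_mul_of_nonneg_left ?_ (hS0 t)
    refine (hball (x := t) ?_).le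
    rw [Real.dist_eq, abs_of_nonneg (by linarith [ht.1])]
    linarith [ht.2]
  rw [intervalIntegral.integral_mul_const, e2, one_mul] at e4
  exact e4.trans_lt (by linarith)

end TimeDerivative

/-! ### From the distributional time derivative to increments in time. -/

section TimeDerivative

variable {σ : ℕ} {n : Fin (σ + 1) → ℕ} {Ω : Set (Coord n)} {T : ℝ} {u w : ℝ → Coord n → ℝ}

/-- Continuity is known only on `[0, T)`, so `u` may blow up at `T` and the bound depends on `t'`.
-/
theorem exists_bound_of_continuousOn (hΩb : Bornology.IsBounded Ω)
    (hu : ContinuousOn (fun z : ℝ × Coord n => u z.1 z.2) (Ico 0 T ×ˢ closure Ω)) {t' : ℝ}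
    (ht' : t' < T) : ∃ K : ℝ, ∀ t ∈ Icc 0 t', ∀ x ∈ closure Ω, |u t x| ≤ K := by
  have hcomp : IsCompact (Icc 0 t' ×ˢ closure Ω) := isCompact_Icc.prod hΩb.isCompact_closure
  obtain ⟨K, hK⟩ := hcomp.exists_bound_of_continuousOn
    (hu.mono (prod_mono_left fun t ht => ⟨ht.1, ht.2.trans_lt ht'⟩))
  exact ⟨K, fun t ht x hx => hK (t, x) ⟨ht, hx⟩⟩

theorem continuousOn_slice
    (hu : ContinuousOn (fun z : ℝ × Coord n => u z.1 z.2) (Ico 0 T ×ˢ closure Ω)) {t : ℝ}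
    (ht : t ∈ Ico 0 T) : ContinuousOn (u t) (closure Ω) :=
  hu.comp (f := fun x => (t, x)) (by fun_prop) fun _ hx => ⟨ht, hx⟩

theorem continuousOn_time
    (hu : ContinuousOn (fun z : ℝ × Coord n => u z.1 z.2) (Ico 0 T ×ˢ closure Ω)) {x : Coord n}
    (hx : x ∈ closure Ω) : ContinuousOn (fun t => u t x) (Ico 0 T) :=
  hu.comp (f := fun t => (t, x)) (by fun_prop) fun _ ht => ⟨ht, hx⟩

theorem aestronglyMeasurable_slice (hΩ : MeasurableSet Ω)
    (hu : ContinuousOn (fun z : ℝ × Coord n => u z.1 z.2) (Ico 0 T ×ˢ closure Ω)) {t : ℝ}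
    (ht : t ∈ Ico 0 T) : AEStronglyMeasurable (u t) (volume.restrict Ω) :=
  ((continuousOn_slice hu ht).mono subset_closure).aestronglyMeasurable hΩ

theorem continuousOn_setIntegral (hΩ : MeasurableSet Ω) (hΩb : Bornology.IsBounded Ω)
    (hu : ContinuousOn (fun z : ℝ × Coord n => u z.1 z.2) (Ico 0 T ×ˢ closure Ω)) :
    ContinuousOn (fun t => ∫ x in Ω, u t x) (Ico 0 T) := by
  intro t ht
  obtain ⟨K, hK⟩ := exists_bound_of_continuousOn hΩb hu (t' := (t + T) / 2) (by linarith [ht.2])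
  have : IsFiniteMeasure (volume.restrict Ω) :=
    ⟨by simpa using hΩb.measure_lt_top⟩
  refine continuousWithinAt_of_dominated (bound := fun _ => K) ?_ ?_ (integrable_const K) ?_
  · filter_upwards [self_mem_nhdsWithin] with τ hτ
    exact aestronglyMeasurable_slice hΩ hu hτ
  · filter_upwards [self_mem_nhdsWithin,
      mem_nhdsWithin_of_mem_nhds (Iio_mem_nhds (by linarith [ht.2] : t < (t + T) / 2))] with τ h1 h2
    filter_upwards [ae_restrict_mem hΩ] with x hx
    exact hK τ ⟨h1.1, le_of_lt h2⟩ x (subset_closure hx)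
  · filter_upwards [ae_restrict_mem hΩ] with x hx
    exact continuousOn_time hu (subset_closure hx) t ht

theorem integral_Ioo_prod_eq {F : ℝ × Coord n → ℝ} {A : Set ℝ}
    (hF : IntegrableOn F (A ×ˢ Ω)) :
    ∫ z in A ×ˢ Ω, F z = ∫ t in A, ∫ x in Ω, F (t, x) := by
  rw [Measure.volume_eq_prod] at hF ⊢
  exact setIntegral_prod F hF

theorem restrict_prod_eq (A : Set ℝ) :
    (volume : Measure (ℝ × Coord n)).restrict (A ×ˢ Ω) =
      (volume.restrict A).prod (volume.restrict Ω) := by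
  rw [Measure.volume_eq_prod, Measure.prod_restrict]

/-- The weak time derivative tested with a function of the space variable. -/
theorem IsTimeDerivL2.integral_mul_sub (hw : IsTimeDerivL2 Ω T u w) (hΩ : MeasurableSet Ω)
    (hΩb : Bornology.IsBounded Ω)
    (hu : ContinuousOn (fun z : ℝ × Coord n => u z.1 z.2) (Ico 0 T ×ˢ closure Ω))
    (hui : IntegrableOn (fun z : ℝ × Coord n => u z.1 z.2) (Ioo 0 T ×ˢ Ω))
    (hwi : IntegrableOn (fun z : ℝ × Coord n => w z.1 z.2) (Ioo 0 T ×ˢ Ω))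
    {b : Coord n → ℝ} (hb : ContDiff ℝ ∞ b) (hbc : HasCompactSupport b) (hbΩ : tsupport b ⊆ Ω)
    {t₁ t₂ : ℝ} (h1 : 0 < t₁) (h12 : t₁ < t₂) (h2 : t₂ < T) :
    (∫ x in Ω, u t₂ x * b x) - ∫ x in Ω, u t₁ x * b x =
      ∫ z in Ioc t₁ t₂ ×ˢ Ω, w z.1 z.2 * b z.2 := by
  set ε : ℕ → ℝ := fun k => (T - t₂) / 2 * (1 / ((k : ℝ) + 1)) with hεdef
  have hε : ∀ k, 0 < ε k := fun k => mul_pos (by linarith) (by positivity)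
  have hεle : ∀ k, ε k ≤ (T - t₂) / 2 := fun k =>
    mul_le_of_le_one_right (by linarith) ((div_le_one (by positivity)).mpr (by simp))
  have hε0 : Tendsto ε atTop (𝓝 0) := by
    simpa [hεdef] using (tendsto_one_div_add_atTop_nhds_zero_nat (𝕜 := ℝ)).const_mul ((T - t₂) / 2)
  obtain ⟨B, hB⟩ := hb.continuous.bounded_above_of_compact_support hbc
  -- A smoothing of the indicator of `(t₁, t₂]`; since `ε k ≤ (T - t₂) / 2`, the test function `a k
  -- t * b x` has compact support in `(0, T) × Ω`. Its time derivative selects the values at `t₁`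
  -- and `t₂` in the limit.
  set a : ℕ → ℝ → ℝ := fun k t => smoothStep t₁ (ε k) t - smoothStep t₂ (ε k) t with hadef
  have ha : ∀ k, ContDiff ℝ ∞ (a k) := fun k =>
    (contDiff_smoothStep _ _).sub (contDiff_smoothStep _ _)
  have had : ∀ k t, deriv (a k) t =
      deriv (smoothStep t₁ (ε k)) t - deriv (smoothStep t₂ (ε k)) t := fun k t =>
    deriv_fun_sub ((contDiff_smoothStep _ _).differentiable (by simp) t)
      ((contDiff_smoothStep _ _).differentiable (by simp) t)
  have ha1 : ∀ k t, |a k t| ≤ 1 := by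
    intro k t
    have e1 : 0 ≤ smoothStep t₁ (ε k) t := Real.smoothTransition.nonneg _
    have e2 : smoothStep t₁ (ε k) t ≤ 1 := Real.smoothTransition.le_one _
    have e3 : 0 ≤ smoothStep t₂ (ε k) t := Real.smoothTransition.nonneg _
    have e4 : smoothStep t₂ (ε k) t ≤ 1 := Real.smoothTransition.le_one _
    exact abs_le.mpr ⟨by simp only [hadef]; linarith, by simp only [hadef]; linarith⟩
  have ha0 : ∀ k t, t ∉ Icc t₁ (t₂ + (T - t₂) / 2) → a k t = 0 := by
    intro k t ht
    rcases lt_or_ge t t₁ with h | h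
    · simp only [hadef, smoothStep_of_le (hε k) h.le, smoothStep_of_le (hε k) (h.le.trans h12.le),
        sub_zero]
    · have h3 : t₂ + (T - t₂) / 2 < t := by
        by_contra! h3
        exact ht ⟨h, h3⟩
      have h4 := hεle k
      simp only [hadef, smoothStep_of_ge (hε k) (by linarith : t₁ + ε k ≤ t),
        smoothStep_of_ge (hε k) (by linarith : t₂ + ε k ≤ t), sub_self]
  have halim : ∀ t, Tendsto (fun k => a k t) atTop (𝓝 ((Ioc t₁ t₂).indicator 1 t)) := by
    have hstep : ∀ c t, c < t → ∀ᶠ k in atTop, smoothStep c (ε k) t = 1 := by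
      intro c t hct
      filter_upwards [hε0.eventually (gt_mem_nhds (sub_pos.mpr hct))] with k hk
      exact smoothStep_of_ge (hε k) (by linarith)
    intro t
    refine tendsto_const_nhds.congr' ?_
    rcases le_or_gt t t₁ with h | h
    · refine Eventually.of_forall fun k => ?_
      simp [hadef, smoothStep_of_le (hε k) h, smoothStep_of_le (hε k) (h.trans h12.le), h]
    rcases le_or_gt t t₂ with h' | h'
    · filter_upwards [hstep t₁ t h] with k hk
      simp [hadef, hk, smoothStep_of_le (hε k) h', h, h']
    · filter_upwards [hstep t₁ t h, hstep t₂ t h'] with k hk hk'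
      simp [hadef, hk, hk', h']
  have hub : IntegrableOn (fun z : ℝ × Coord n => u z.1 z.2 * b z.2) (Ioo 0 T ×ˢ Ω) :=
    hui.mul_bdd (c := B) (hb.continuous.comp continuous_snd).aestronglyMeasurable
      (ae_of_all _ fun z => hB z.2)
  have hwb : IntegrableOn (fun z : ℝ × Coord n => w z.1 z.2 * b z.2) (Ioo 0 T ×ˢ Ω) :=
    hwi.mul_bdd (c := B) (hb.continuous.comp continuous_snd).aestronglyMeasurable
      (ae_of_all _ fun z => hB z.2)
  set U : ℝ → ℝ := fun t => ∫ x in Ω, u t x * b x with hU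
  have hUc : ContinuousOn U (Ioo 0 T) :=
    (continuousOn_setIntegral (u := fun t x => u t x * b x) hΩ hΩb
      (hu.mul (hb.continuous.comp continuous_snd).continuousOn)).mono Ioo_subset_Ico_self
  have hident : ∀ k, (∫ t in Ioo 0 T, deriv (smoothStep t₁ (ε k)) t * U t) -
      (∫ t in Ioo 0 T, deriv (smoothStep t₂ (ε k)) t * U t) =
      -∫ z in Ioo 0 T ×ˢ Ω, a k z.1 * (w z.1 z.2 * b z.2) := by
    intro k
    have hψs : ContDiff ℝ ∞ fun z : ℝ × Coord n => a k z.1 * b z.2 :=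
      ((ha k).comp contDiff_fst).mul (hb.comp contDiff_snd)
    have hsupp : Function.support (fun z : ℝ × Coord n => a k z.1 * b z.2) ⊆
        Icc t₁ (t₂ + (T - t₂) / 2) ×ˢ tsupport b := by
      intro z hz
      refine ⟨?_, subset_tsupport _ (right_ne_zero_of_mul hz)⟩
      by_contra h
      exact left_ne_zero_of_mul hz (ha0 k _ h)
    have hcomp : IsCompact (Icc t₁ (t₂ + (T - t₂) / 2) ×ˢ tsupport b) := isCompact_Icc.prod hbc
    have hts : tsupport (fun z : ℝ × Coord n => a k z.1 * b z.2) ⊆ Ioo 0 T ×ˢ Ω :=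
      (closure_minimal hsupp hcomp.isClosed).trans
        (prod_mono (fun t ht => ⟨h1.trans_le ht.1, by linarith [ht.2]⟩) hbΩ)
    have h := hw.2 _ hψs (HasCompactSupport.of_support_subset_isCompact hcomp hsupp) hts
    have hfd : ∀ z : ℝ × Coord n, fderiv ℝ (fun z : ℝ × Coord n => a k z.1 * b z.2) z (1, 0) =
        deriv (a k) z.1 * b z.2 := by
      intro z
      have e1 : HasFDerivAt (fun z : ℝ × Coord n => a k z.1)
          ((ContinuousLinearMap.toSpanSingleton ℝ (deriv (a k) z.1)).comp
            (ContinuousLinearMap.fst ℝ ℝ (Coord n))) z :=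
        ((ha k).differentiable (by simp) z.1).hasDerivAt.hasFDerivAt.comp z hasFDerivAt_fst
      have e2 : HasFDerivAt (fun z : ℝ × Coord n => b z.2)
          ((fderiv ℝ b z.2).comp (ContinuousLinearMap.snd ℝ ℝ (Coord n))) z :=
        (hb.differentiable (by simp) z.2).hasFDerivAt.comp z hasFDerivAt_snd
      have e3 : HasFDerivAt (fun z : ℝ × Coord n => a k z.1 * b z.2) _ z := e1.mul e2
      rw [e3.fderiv]
      simp [mul_comm]
    simp only [hfd] at h
    have hSb : ∀ c, ∃ D, ∀ t ∈ Ioo 0 T, ‖deriv (smoothStep c (ε k)) t‖ ≤ D := by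
      intro c
      obtain ⟨D, hD⟩ := (isCompact_Icc (a := (0 : ℝ)) (b := T)).exists_bound_of_continuousOn
        ((contDiff_smoothStep c (ε k)).continuous_deriv (by simp)).continuousOn
      exact ⟨D, fun t ht => hD t (Ioo_subset_Icc_self ht)⟩
    have hSi : ∀ c, IntegrableOn (fun z : ℝ × Coord n =>
        deriv (smoothStep c (ε k)) z.1 * (u z.1 z.2 * b z.2)) (Ioo 0 T ×ˢ Ω) := by
      intro c
      obtain ⟨D, hD⟩ := hSb c
      refine hub.bdd_mul (c := D) ((((contDiff_smoothStep c (ε k)).continuous_deriv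
        (by simp)).comp continuous_fst).aestronglyMeasurable) ?_
      filter_upwards [ae_restrict_mem (measurableSet_Ioo.prod hΩ)] with z hz
      exact hD _ hz.1
    have hSe : ∀ c, ∫ z in Ioo 0 T ×ˢ Ω, deriv (smoothStep c (ε k)) z.1 * (u z.1 z.2 * b z.2) =
        ∫ t in Ioo 0 T, deriv (smoothStep c (ε k)) t * U t := by
      intro c
      rw [integral_Ioo_prod_eq (hSi c)]
      simp only [integral_const_mul, hU]
    rw [← hSe, ← hSe, ← integral_sub (hSi _) (hSi _)]
    refine Eq.trans ?_ (h.trans ?_)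
    · refine integral_congr_ae (ae_of_all _ fun z => ?_)
      simp only [had]
      ring
    · refine congrArg Neg.neg (integral_congr_ae (ae_of_all _ fun z => ?_))
      ring
  have hL := (tendsto_integral_deriv_smoothStep_mul (c := t₁) ⟨h1, h12.trans h2⟩ hUc hε hε0).sub
    (tendsto_integral_deriv_smoothStep_mul (c := t₂) ⟨h1.trans h12, h2⟩ hUc hε hε0)
  simp only [hident] at hL
  have hR : Tendsto (fun k => ∫ z in Ioo 0 T ×ˢ Ω, a k z.1 * (w z.1 z.2 * b z.2)) atTop
      (𝓝 (∫ z in Ioo 0 T ×ˢ Ω, (Ioc t₁ t₂).indicator 1 z.1 * (w z.1 z.2 * b z.2))) := by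
    refine tendsto_integral_of_dominated_convergence (fun z => ‖w z.1 z.2 * b z.2‖)
      (fun k => (((ha k).continuous.comp continuous_fst).aestronglyMeasurable).mul hwb.1)
      hwb.norm (fun k => ae_of_all _ fun z => ?_) (ae_of_all _ fun z => (halim z.1).mul_const _)
    rw [norm_mul]
    exact mul_le_of_le_one_left (norm_nonneg _) (ha1 k z.1)
  have hsub : Ioc t₁ t₂ ⊆ Ioo 0 T := fun t ht => ⟨h1.trans ht.1, ht.2.trans_lt h2⟩
  have hRe : ∫ z in Ioo 0 T ×ˢ Ω, (Ioc t₁ t₂).indicator 1 z.1 * (w z.1 z.2 * b z.2) =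
      ∫ z in Ioc t₁ t₂ ×ˢ Ω, w z.1 z.2 * b z.2 := by
    have e1 : (fun z : ℝ × Coord n => (Ioc t₁ t₂).indicator 1 z.1 * (w z.1 z.2 * b z.2)) =
        (Ioc t₁ t₂ ×ˢ univ).indicator fun z : ℝ × Coord n => w z.1 z.2 * b z.2 := by
      funext z
      by_cases hz : z.1 ∈ Ioc t₁ t₂
      · rw [indicator_of_mem hz, indicator_of_mem (show z ∈ Ioc t₁ t₂ ×ˢ univ from ⟨hz, trivial⟩)]
        simp
      · rw [indicator_of_notMem hz,
          indicator_of_notMem (show z ∉ Ioc t₁ t₂ ×ˢ univ from fun h => hz h.1), zero_mul]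
    rw [e1, setIntegral_indicator (measurableSet_Ioc.prod MeasurableSet.univ), prod_inter_prod,
      inter_univ, inter_eq_self_of_subset_right hsub]
  rw [hRe] at hR
  have := tendsto_nhds_unique hL hR.neg
  linarith

/-- For almost every `x`, increments of `u (·) x` are integrals of the weak time derivative. -/
theorem IsTimeDerivL2.ae_sub_eq (hw : IsTimeDerivL2 Ω T u w) (hΩ : IsOpen Ω)
    (hΩb : Bornology.IsBounded Ω)
    (hu : ContinuousOn (fun z : ℝ × Coord n => u z.1 z.2) (Ico 0 T ×ˢ closure Ω))
    (hui : IntegrableOn (fun z : ℝ × Coord n => u z.1 z.2) (Ioo 0 T ×ˢ Ω))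
    (hwi : IntegrableOn (fun z : ℝ × Coord n => w z.1 z.2) (Ioo 0 T ×ˢ Ω))
    {t₁ t₂ : ℝ} (h1 : 0 < t₁) (h12 : t₁ < t₂) (h2 : t₂ < T) :
    ∀ᵐ x ∂(volume.restrict Ω), u t₂ x - u t₁ x = ∫ t in t₁..t₂, w t x := by
  have : IsFiniteMeasure (volume.restrict Ω) := ⟨by simpa using hΩb.measure_lt_top⟩
  have hsub : Ioc t₁ t₂ ⊆ Ioo 0 T := fun t ht => ⟨h1.trans ht.1, ht.2.trans_lt h2⟩
  have hslice : ∀ t ∈ Ico 0 T, Integrable (u t) (volume.restrict Ω) := by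
    intro t ht
    obtain ⟨K, hK⟩ := exists_bound_of_continuousOn hΩb hu ht.2
    refine Integrable.of_bound (aestronglyMeasurable_slice hΩ.measurableSet hu ht) K ?_
    filter_upwards [ae_restrict_mem hΩ.measurableSet] with x hx
    exact hK t ⟨ht.1, le_rfl⟩ x (subset_closure hx)
  have hwi' : Integrable (fun z : ℝ × Coord n => w z.1 z.2)
      ((volume.restrict (Ioc t₁ t₂)).prod (volume.restrict Ω)) := by
    rw [← restrict_prod_eq]
    exact hwi.mono_set (prod_mono_left hsub)
  have hWi : Integrable (fun x => ∫ t in Ioc t₁ t₂, w t x) (volume.restrict Ω) :=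
    hwi'.integral_prod_right
  have i1 := hslice t₁ ⟨h1.le, h12.trans h2⟩
  have i2 := hslice t₂ ⟨(h1.trans h12).le, h2⟩
  have hloc : LocallyIntegrableOn (fun x => u t₂ x - u t₁ x - ∫ t in Ioc t₁ t₂, w t x) Ω :=
    IntegrableOn.locallyIntegrableOn ((i2.sub i1).sub hWi)
  -- Fundamental lemma of the calculus of variations in the space variable.
  have hae := hΩ.ae_eq_zero_of_integral_contDiff_smul_eq_zero hloc fun b hb hbc hbΩ => ?_
  · rw [ae_restrict_iff' hΩ.measurableSet]
    filter_upwards [hae] with x hx hxΩ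
    rw [intervalIntegral.integral_of_le h12.le]
    linarith [hx hxΩ]
  · obtain ⟨B, hB⟩ := hb.continuous.bounded_above_of_compact_support hbc
    have hmain := hw.integral_mul_sub hΩ.measurableSet hΩb hu hui hwi hb hbc hbΩ h1 h12 h2
    have hbm : AEStronglyMeasurable b (volume.restrict Ω) := hb.continuous.aestronglyMeasurable
    have hwb : Integrable (fun z : ℝ × Coord n => w z.1 z.2 * b z.2)
        ((volume.restrict (Ioc t₁ t₂)).prod (volume.restrict Ω)) :=
      hwi'.mul_bdd (c := B) (hb.continuous.comp continuous_snd).aestronglyMeasurable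
        (ae_of_all _ fun z => hB z.2)
    rw [restrict_prod_eq, integral_prod_symm _ hwb] at hmain
    simp only [integral_mul_const] at hmain
    have j1 := i1.mul_bdd (c := B) hbm (ae_of_all _ hB)
    have j2 := i2.mul_bdd (c := B) hbm (ae_of_all _ hB)
    have j3 := hWi.mul_bdd (c := B) hbm (ae_of_all _ hB)
    have e0 : ∀ x, x ∉ Ω → b x • (u t₂ x - u t₁ x - ∫ t in Ioc t₁ t₂, w t x) = 0 := by
      intro x hx
      rw [image_eq_zero_of_notMem_tsupport fun h => hx (hbΩ h), zero_smul]
    rw [← setIntegral_eq_integral_of_forall_compl_eq_zero e0]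
    have e1 : ∀ x, b x • (u t₂ x - u t₁ x - ∫ t in Ioc t₁ t₂, w t x) =
        u t₂ x * b x - u t₁ x * b x - (∫ t in Ioc t₁ t₂, w t x) * b x := by
      intro x
      rw [smul_eq_mul]
      ring
    simp only [e1]
    have j21 : Integrable (fun x => u t₂ x * b x - u t₁ x * b x) (volume.restrict Ω) := j2.sub j1
    rw [integral_sub j21 j3, integral_sub j2 j1, hmain, sub_self]

end TimeDerivative

/-! ### Time increments of `∫ u^s`. -/

section TimeDerivative

variable {σ : ℕ} {n : Fin (σ + 1) → ℕ} {Ω : Set (Coord n)} {T : ℝ} {u w : ℝ → Coord n → ℝ}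

theorem IsTimeDerivL2.integral_rpow_sub (hw : IsTimeDerivL2 Ω T u w) (hΩ : IsOpen Ω)
    (hΩb : Bornology.IsBounded Ω)
    (hu : ContinuousOn (fun z : ℝ × Coord n => u z.1 z.2) (Ico 0 T ×ˢ closure Ω))
    (hu0 : ∀ t ∈ Ioo 0 T, ∀ x ∈ Ω, 0 ≤ u t x)
    (hui : IntegrableOn (fun z : ℝ × Coord n => u z.1 z.2) (Ioo 0 T ×ˢ Ω))
    (hwi : IntegrableOn (fun z : ℝ × Coord n => w z.1 z.2) (Ioo 0 T ×ˢ Ω))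
    {t₁ t₂ s : ℝ} (hs : 1 < s) (h1 : 0 < t₁) (h12 : t₁ < t₂) (h2 : t₂ < T) :
    (∫ x in Ω, u t₂ x ^ s) - ∫ x in Ω, u t₁ x ^ s =
      s * ∫ z in Ioo t₁ t₂ ×ˢ Ω, w z.1 z.2 * u z.1 z.2 ^ (s - 1) := by
  have : IsFiniteMeasure (volume.restrict Ω) := ⟨by simpa using hΩb.measure_lt_top⟩
  have hsub : Ioo t₁ t₂ ⊆ Ioo 0 T := fun t ht => ⟨h1.trans ht.1, ht.2.trans h2⟩
  have hsubc : Icc t₁ t₂ ⊆ Ico 0 T := fun t ht => ⟨h1.le.trans ht.1, ht.2.trans_lt h2⟩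
  obtain ⟨K, hK⟩ := exists_bound_of_continuousOn hΩb hu h2
  have hslice : ∀ t ∈ Icc t₁ t₂, Integrable (fun x => u t x ^ s) (volume.restrict Ω) := by
    intro t ht
    refine integrable_rpow_of_bounded (aestronglyMeasurable_slice hΩ.measurableSet hu (hsubc ht))
      (K := K) ?_ (by linarith)
    filter_upwards [ae_restrict_mem hΩ.measurableSet] with x hx
    exact ⟨hu0 t ⟨h1.trans_le ht.1, ht.2.trans_lt h2⟩ x hx,
      (le_abs_self _).trans (hK t ⟨h1.le.trans ht.1, ht.2⟩ x (subset_closure hx))⟩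
  have hwi' : Integrable (fun z : ℝ × Coord n => w z.1 z.2)
      ((volume.restrict (Ioo t₁ t₂)).prod (volume.restrict Ω)) := by
    rw [← restrict_prod_eq]
    exact hwi.mono_set (prod_mono_left hsub)
  have hwu : Integrable (fun z : ℝ × Coord n => w z.1 z.2 * u z.1 z.2 ^ (s - 1))
      ((volume.restrict (Ioo t₁ t₂)).prod (volume.restrict Ω)) := by
    refine integrable_mul_rpow_of_bounded (K := K) ?_ ?_ (by linarith) hwi'
    · rw [← restrict_prod_eq]
      exact hui.1.mono_set (prod_mono_left hsub)
    · rw [← restrict_prod_eq]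
      filter_upwards [ae_restrict_mem (measurableSet_Ioo.prod hΩ.measurableSet)] with z hz
      exact ⟨hu0 _ (hsub hz.1) _ hz.2, (le_abs_self _).trans
        (hK _ ⟨h1.le.trans hz.1.1.le, hz.1.2.le⟩ _ (subset_closure hz.2))⟩
  -- The exceptional null set depends on the end time. Rational times share one null set, and
  -- continuity in time then gives all of `[t₁, t₂]`.
  have hrat : ∀ᵐ x ∂(volume.restrict Ω), ∀ ρ : ℚ, (ρ : ℝ) ∈ Ioo t₁ t₂ →
      u ρ x - u t₁ x = ∫ t in t₁..ρ, w t x := by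
    refine ae_all_iff.mpr fun ρ => ?_
    by_cases hρ : (ρ : ℝ) ∈ Ioo t₁ t₂
    · filter_upwards [hw.ae_sub_eq hΩ hΩb hu hui hwi h1 hρ.1 (hρ.2.trans h2)] with x hx _
      exact hx
    · exact ae_of_all _ fun x h => absurd h hρ
  have hpt : ∀ᵐ x ∂(volume.restrict Ω), u t₂ x ^ s - u t₁ x ^ s =
      s * ∫ t in Ioo t₁ t₂, w t x * u t x ^ (s - 1) := by
    filter_upwards [hrat, hwi'.prod_left_ae, ae_restrict_mem hΩ.measurableSet] with x hx hwx hxΩ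
    have hint : IntervalIntegrable (fun t => w t x) volume t₁ t₂ :=
      (intervalIntegrable_iff_integrableOn_Ioo_of_le h12.le).mpr hwx
    have hc1 : ContinuousOn (fun t => u t x - u t₁ x) (Icc t₁ t₂) :=
      ((continuousOn_time hu (subset_closure hxΩ)).mono hsubc).sub continuousOn_const
    have hc2 : ContinuousOn (fun t => ∫ τ in t₁..t, w τ x) (Icc t₁ t₂) := by
      have := intervalIntegral.continuousOn_primitive_interval' hint left_mem_uIcc
      rwa [uIcc_of_le h12.le] at this
    have heq : EqOn (fun t => u t x - u t₁ x) (fun t => ∫ τ in t₁..t, w τ x) (Icc t₁ t₂) := by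
      refine EqOn.of_subset_closure (s := Ioo t₁ t₂ ∩ range ((↑) : ℚ → ℝ)) ?_ hc1 hc2
        (inter_subset_left.trans Ioo_subset_Icc_self) ?_
      · rintro t ⟨ht, ρ, rfl⟩
        exact hx ρ ht
      · rw [← closure_Ioo h12.ne]
        exact closure_minimal
          (Rat.denseRange_cast.open_subset_closure_inter isOpen_Ioo) isClosed_closure
    rw [rpow_sub_rpow_eq_integral h12.le hs hint (fun t ht => heq ht) fun t ht =>
      hu0 t ⟨h1.trans_le ht.1, ht.2.trans_lt h2⟩ x hxΩ,
      intervalIntegral.integral_of_le h12.le, integral_Ioc_eq_integral_Ioo, ← integral_const_mul]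
    refine integral_congr_ae (ae_of_all _ fun t => ?_)
    ring
  rw [← integral_sub (hslice t₂ ⟨h12.le, le_rfl⟩) (hslice t₁ ⟨le_rfl, h12.le⟩),
    integral_congr_ae hpt, integral_const_mul, restrict_prod_eq, integral_prod_symm _ hwu]

end TimeDerivative

/-! ### Admissibility of time-localized powers as test functions. -/

section Testing

/-- A continuous cutoff in time, supported in `[t₁, t₂]`, with slope `k`. -/
def timeCutoff (t₁ t₂ : ℝ) (k : ℕ) (t : ℝ) : ℝ := max 0 (min 1 (k * min (t - t₁) (t₂ - t)))

theorem continuous_timeCutoff (t₁ t₂ : ℝ) (k : ℕ) : Continuous (timeCutoff t₁ t₂ k) := by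
  unfold timeCutoff
  fun_prop

theorem timeCutoff_nonneg (t₁ t₂ : ℝ) (k : ℕ) (t : ℝ) : 0 ≤ timeCutoff t₁ t₂ k t :=
  le_max_left _ _

theorem timeCutoff_le_one (t₁ t₂ : ℝ) (k : ℕ) (t : ℝ) : timeCutoff t₁ t₂ k t ≤ 1 :=
  max_le zero_le_one (min_le_left _ _)

theorem timeCutoff_of_notMem {t₁ t₂ t : ℝ} (k : ℕ) (h : t ∉ Ioo t₁ t₂) :
    timeCutoff t₁ t₂ k t = 0 := by
  have h1 : min (t - t₁) (t₂ - t) ≤ 0 := by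
    by_contra! h1
    exact h ⟨by linarith [(lt_min_iff.mp h1).1], by linarith [(lt_min_iff.mp h1).2]⟩
  exact max_eq_left ((min_le_right _ _).trans
    (mul_nonpos_of_nonneg_of_nonpos (Nat.cast_nonneg k) h1))

theorem tendsto_timeCutoff {t₁ t₂ t : ℝ} (h : t ∈ Ioo t₁ t₂) :
    Tendsto (fun k => timeCutoff t₁ t₂ k t) atTop (𝓝 1) := by
  have h1 : 0 < min (t - t₁) (t₂ - t) := lt_min (by linarith [h.1]) (by linarith [h.2])
  have h2 : Tendsto (fun k : ℕ => (k : ℝ) * min (t - t₁) (t₂ - t)) atTop atTop :=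
    tendsto_natCast_atTop_atTop.atTop_mul_const h1
  refine tendsto_const_nhds.congr' ?_
  filter_upwards [h2.eventually_ge_atTop 1] with k hk
  rw [timeCutoff, min_eq_left hk, max_eq_right zero_le_one]

variable {σ : ℕ} {n : Fin (σ + 1) → ℕ} {Ω : Set (Coord n)} {T : ℝ}

theorem tendsto_integral_timeCutoff_mul (hΩ : MeasurableSet Ω) {t₁ t₂ : ℝ} (h1 : 0 < t₁)
    (h2 : t₂ < T) {F : ℝ × Coord n → ℝ} (hF : IntegrableOn F (Ioo t₁ t₂ ×ˢ Ω)) :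
    Tendsto (fun k => ∫ z in Ioo 0 T ×ˢ Ω, timeCutoff t₁ t₂ k z.1 * F z) atTop
      (𝓝 (∫ z in Ioo t₁ t₂ ×ˢ Ω, F z)) := by
  have e1 : ∀ k, ∫ z in Ioo 0 T ×ˢ Ω, timeCutoff t₁ t₂ k z.1 * F z =
      ∫ z in Ioo t₁ t₂ ×ˢ Ω, timeCutoff t₁ t₂ k z.1 * F z := by
    intro k
    refine setIntegral_eq_of_subset_of_forall_sdiff_eq_zero (measurableSet_Ioo.prod hΩ)
      (prod_mono_left fun t ht => ⟨h1.trans ht.1, ht.2.trans h2⟩) fun z hz => ?_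
    rw [timeCutoff_of_notMem k fun h => hz.2 ⟨h, hz.1.2⟩, zero_mul]
  simp only [e1]
  refine tendsto_integral_of_dominated_convergence (fun z => ‖F z‖)
    (fun k => (((continuous_timeCutoff t₁ t₂ k).comp continuous_fst).aestronglyMeasurable).mul hF.1)
    hF.norm (fun k => ae_of_all _ fun z => ?_) ?_
  · rw [norm_mul, Real.norm_of_nonneg (timeCutoff_nonneg _ _ _ _)]
    exact mul_le_of_le_one_left (norm_nonneg _) (timeCutoff_le_one _ _ _ _)
  · filter_upwards [ae_restrict_mem (measurableSet_Ioo.prod hΩ)] with z hz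
    simpa using (tendsto_timeCutoff hz.1).mul_const (F z)

theorem abs_rpow_sub_one_mul_self {v q : ℝ} (hv : 0 ≤ v) (hq : 0 < q) :
    |v| ^ (q - 1) * v = v ^ q := by
  rw [abs_of_nonneg hv]
  rcases hv.eq_or_lt with rfl | hv
  · rw [mul_zero, Real.zero_rpow hq.ne']
  · rw [Real.rpow_sub_one hv.ne', div_mul_cancel₀ _ hv.ne']

theorem norm_rpow_sub_two_mul_inner_smul {E : Type*} [NormedAddCommGroup E]
    [InnerProductSpace ℝ E] (v : E) (c : ℝ) {p : ℝ} (hp : 0 < p) :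
    ‖v‖ ^ (p - 2) * inner ℝ v (c • v) = c * ‖v‖ ^ p := by
  rw [inner_smul_right, real_inner_self_eq_norm_sq]
  -- For `p < 2` the factor `‖v‖ ^ (p - 2)` is singular at `v = 0`, but there the inner product
  -- vanishes.
  rcases (norm_nonneg v).eq_or_lt with h | h
  · rw [← h, Real.zero_rpow hp.ne']
    simp
  · have : ‖v‖ ^ p = ‖v‖ ^ (p - 2) * ‖v‖ ^ 2 := by
      rw [← Real.rpow_natCast, ← Real.rpow_add h]
      norm_num
    rw [this]
    ring

namespace StratifiedGroup

variable {G : StratifiedGroup n}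

theorem IsSobolevZero.const_mul {s : ENNReal} {f : Coord n → ℝ}
    {g : Coord n → EuclideanSpace ℝ (Fin (n 0))} (h : G.IsSobolevZero Ω s f g)
    (hs : 1 ≤ s) (hs' : s ≠ ⊤) (c : ℝ) :
    G.IsSobolevZero Ω s (fun x => c * f x) (fun x => c • g x) := by
  have := h.comp_integral hs hs' (H := fun _ => c) continuous_const (fun _ => le_rfl)
  simpa [mul_comm c] using this

/-- Power functions of a weak solution, cut off in time, are admissible test functions. -/
theorem isBochnerSobolevZero_timeCutoff_mul_rpow (hΩ : IsOpen Ω) (hΩb : Bornology.IsBounded Ω)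
    {u : ℝ → Coord n → ℝ} {g : ℝ → Coord n → EuclideanSpace ℝ (Fin (n 0))} {p r a : ℝ}
    (hp : 1 < p) (hpr : p ≤ r) (ha : 1 < a)
    (hu : ContinuousOn (fun z : ℝ × Coord n => u z.1 z.2) (Ico 0 T ×ˢ closure Ω))
    (hu0 : ∀ t ∈ Ioo 0 T, ∀ x ∈ Ω, 0 ≤ u t x)
    (hug : G.IsBochnerSobolevZero Ω T (ENNReal.ofReal r) u g) {t₁ t₂ : ℝ}
    (h2 : t₂ < T) (k : ℕ) :
    G.IsBochnerSobolevZero Ω T (ENNReal.ofReal p)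
      (fun t x => timeCutoff t₁ t₂ k t * u t x ^ a)
      (fun t x => (timeCutoff t₁ t₂ k t * (a * u t x ^ (a - 1))) • g t x) := by
  obtain ⟨hum, hgm, hae⟩ := hug
  have hΩf : volume Ω ≠ ⊤ := hΩb.measure_lt_top.ne
  have hfin1 : IsFiniteMeasure (volume.restrict Ω) := ⟨by simpa using hΩb.measure_lt_top⟩
  have hfin : IsFiniteMeasure ((volume : Measure (ℝ × Coord n)).restrict (Ioo 0 T ×ˢ Ω)) := by
    rw [restrict_prod_eq]
    infer_instance
  have hp1 : 1 ≤ ENNReal.ofReal p := by simpa using hp.le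
  have hpr' : ENNReal.ofReal p ≤ ENNReal.ofReal r := ENNReal.ofReal_le_ofReal hpr
  obtain ⟨K, hK⟩ := exists_bound_of_continuousOn hΩb hu h2
  have hbound : ∀ b : ℝ, 0 ≤ b → ∀ z ∈ Ioo 0 T ×ˢ Ω,
      ‖timeCutoff t₁ t₂ k z.1 * u z.1 z.2 ^ b‖ ≤ |K| ^ b := by
    intro b hb z hz
    have hz0 := hu0 _ hz.1 _ hz.2
    by_cases ht : z.1 ∈ Ioo t₁ t₂
    · have huK : u z.1 z.2 ≤ |K| := ((le_abs_self _).trans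
        (hK _ ⟨hz.1.1.le, ht.2.le⟩ _ (subset_closure hz.2))).trans (le_abs_self _)
      rw [norm_mul, Real.norm_of_nonneg (timeCutoff_nonneg _ _ _ _),
        Real.norm_of_nonneg (Real.rpow_nonneg hz0 _)]
      exact (mul_le_of_le_one_left (Real.rpow_nonneg hz0 _) (timeCutoff_le_one _ _ _ _)).trans
        (Real.rpow_le_rpow hz0 huK hb)
    · rw [timeCutoff_of_notMem k ht, zero_mul, norm_zero]
      positivity
  have hmeas : ∀ b : ℝ, 0 ≤ b → AEStronglyMeasurable
      (fun z : ℝ × Coord n => timeCutoff t₁ t₂ k z.1 * u z.1 z.2 ^ b)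
      (volume.restrict (Ioo 0 T ×ˢ Ω)) := fun b hb =>
    (((continuous_timeCutoff t₁ t₂ k).comp continuous_fst).aestronglyMeasurable).mul
      ((Real.continuous_rpow_const hb).comp_aestronglyMeasurable hum.1)
  refine ⟨MemLp.of_bound (hmeas a (by linarith)) (|K| ^ a) ?_, ?_, ?_⟩
  · filter_upwards [ae_restrict_mem (measurableSet_Ioo.prod hΩ.measurableSet)] with z hz
    exact hbound a (by linarith) z hz
  · refine (hgm.mono_exponent hpr').of_le_mul (c := a * |K| ^ (a - 1)) ?_ ?_
    · refine (((hmeas (a - 1) (by linarith)).const_mul a).congr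
        (ae_of_all _ fun z => ?_)).smul hgm.1
      simp only []
      ring
    · filter_upwards [ae_restrict_mem (measurableSet_Ioo.prod hΩ.measurableSet)] with z hz
      rw [norm_smul]
      refine mul_le_mul_of_nonneg_right ?_ (norm_nonneg _)
      rw [mul_left_comm, norm_mul, Real.norm_of_nonneg (by linarith : (0 : ℝ) ≤ a)]
      exact mul_le_mul_of_nonneg_left (hbound (a - 1) (by linarith) z hz) (by linarith)
  · filter_upwards [hae, ae_restrict_mem measurableSet_Ioo] with t ht htT
    obtain ⟨K', hK'⟩ := exists_bound_of_continuousOn hΩb hu htT.2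
    have h3 := ((ht.mono_exponent hΩf hp1 hpr' ENNReal.ofReal_ne_top).rpow hp1
      ENNReal.ofReal_ne_top ha (K := K') (by
        filter_upwards [ae_restrict_mem hΩ.measurableSet] with x hx
        exact ⟨hu0 t htT x hx,
          (le_abs_self _).trans (hK' t ⟨htT.1.le, le_rfl⟩ x (subset_closure hx))⟩)).const_mul hp1
      ENNReal.ofReal_ne_top (timeCutoff t₁ t₂ k t)
    simpa only [smul_smul] using h3

theorem continuousOn_timeCutoff_mul_rpow {u : ℝ → Coord n → ℝ} {a : ℝ} (ha : 0 ≤ a)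
    (hu : ContinuousOn (fun z : ℝ × Coord n => u z.1 z.2) (Ico 0 T ×ˢ closure Ω))
    {t₁ t₂ : ℝ} (h1 : 0 < t₁) (h12 : t₁ < t₂) (h2 : t₂ < T) (k : ℕ) :
    ContinuousOn (fun z : ℝ × Coord n => timeCutoff t₁ t₂ k z.1 * u z.1 z.2 ^ a)
      (Icc 0 T ×ˢ closure Ω) := by
  -- Test functions must be continuous up to `t = T`, where `u` is not controlled. Freezing `u`
  -- after `t₂` changes nothing, because the cutoff vanishes there.
  have e1 : (fun z : ℝ × Coord n => timeCutoff t₁ t₂ k z.1 * u z.1 z.2 ^ a) =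
      fun z : ℝ × Coord n => timeCutoff t₁ t₂ k z.1 * u (min z.1 t₂) z.2 ^ a := by
    funext z
    rcases le_or_gt z.1 t₂ with h | h
    · rw [min_eq_left h]
    · rw [timeCutoff_of_notMem k fun h' => h.not_gt h'.2, zero_mul, zero_mul]
  rw [e1]
  refine ((continuous_timeCutoff t₁ t₂ k).comp continuous_fst).continuousOn.mul
    ((Real.continuous_rpow_const ha).comp_continuousOn ?_)
  refine hu.comp (f := fun z : ℝ × Coord n => (min z.1 t₂, z.2)) (by fun_prop) fun z hz => ?_
  exact ⟨⟨le_min hz.1.1 (h1.trans h12).le, (min_le_right _ _).trans_lt h2⟩, hz.2⟩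

end StratifiedGroup

end Testing

/-! ### Energy inequality. -/

section Energy

namespace StratifiedGroup

variable {σ : ℕ} {n : Fin (σ + 1) → ℕ} {G : StratifiedGroup n} {Ω : Set (Coord n)}

/-- A weak solution tested with its own powers on a time interval. -/
theorem IsWeakSolution.exists_power_test {P : Params} {u₀ : Coord n → ℝ} {T : ℝ}
    {u : ℝ → Coord n → ℝ} (h : G.IsWeakSolution Ω P u₀ T u) (hΩ : IsOpen Ω)
    (hΩb : Bornology.IsBounded Ω) (hp : 1 < P.p) (hpr : P.p < P.r) (hq : 0 < P.q)
    (hqr : P.q ≤ P.r) {a : ℝ} (ha : 1 < a) :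
    ∃ (g : ℝ → Coord n → EuclideanSpace ℝ (Fin (n 0))) (w : ℝ → Coord n → ℝ),
      G.IsBochnerSobolevZero Ω T (ENNReal.ofReal P.r) u g ∧ IsTimeDerivL2 Ω T u w ∧
      ∀ t₁ t₂, 0 < t₁ → t₁ < t₂ → t₂ < T →
        IntegrableOn (fun z : ℝ × Coord n => w z.1 z.2 * u z.1 z.2 ^ a) (Ioo t₁ t₂ ×ˢ Ω) ∧
        IntegrableOn (fun z : ℝ × Coord n => ‖g z.1 z.2‖ ^ P.p * u z.1 z.2 ^ (a - 1))
          (Ioo t₁ t₂ ×ˢ Ω) ∧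
        IntegrableOn (fun z : ℝ × Coord n => ‖g z.1 z.2‖ ^ P.r * u z.1 z.2 ^ a)
          (Ioo t₁ t₂ ×ˢ Ω) ∧
        IntegrableOn (fun z : ℝ × Coord n => u z.1 z.2 ^ P.q * u z.1 z.2 ^ a)
          (Ioo t₁ t₂ ×ˢ Ω) ∧
        ∫ z in Ioo t₁ t₂ ×ˢ Ω, (P.α * (u z.1 z.2 ^ P.q * u z.1 z.2 ^ a) +
            P.β * (‖g z.1 z.2‖ ^ P.r * u z.1 z.2 ^ a)) ≤
          ∫ z in Ioo t₁ t₂ ×ˢ Ω, (w z.1 z.2 * u z.1 z.2 ^ a +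
            a * (‖g z.1 z.2‖ ^ P.p * u z.1 z.2 ^ (a - 1))) := by
  -- The integral inequality is the super-solution one; the sub-solution contributes only `u ≤ 0` on
  -- the lateral boundary, which makes the test function vanish there.
  obtain ⟨⟨hu0, hu, -, hfr1, g, w, hug, hw, htest⟩, -, -, -, hfr2, -⟩ := h
  have hmax : max P.p (max P.q P.r) = P.r := by rw [max_eq_right hqr, max_eq_right hpr.le]
  rw [hmax] at hug
  refine ⟨g, w, hug, hw, fun t₁ t₂ h1 h12 h2 => ?_⟩
  have hfin1 : IsFiniteMeasure (volume.restrict Ω) := ⟨by simpa using hΩb.measure_lt_top⟩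
  have hfin : IsFiniteMeasure ((volume : Measure (ℝ × Coord n)).restrict (Ioo 0 T ×ˢ Ω)) := by
    rw [restrict_prod_eq]
    infer_instance
  have hsub : Ioo t₁ t₂ ⊆ Ioo 0 T := fun t ht => ⟨h1.trans ht.1, ht.2.trans h2⟩
  have hle : (volume : Measure (ℝ × Coord n)).restrict (Ioo t₁ t₂ ×ˢ Ω) ≤
      volume.restrict (Ioo 0 T ×ˢ Ω) := Measure.restrict_mono_set _ (prod_mono_left hsub)
  have hfin2 : IsFiniteMeasure ((volume : Measure (ℝ × Coord n)).restrict (Ioo t₁ t₂ ×ˢ Ω)) :=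
    isFiniteMeasure_of_le _ hle
  have hmeasQ : MeasurableSet (Ioo t₁ t₂ ×ˢ Ω) := measurableSet_Ioo.prod hΩ.measurableSet
  have hum : AEStronglyMeasurable (fun z : ℝ × Coord n => u z.1 z.2)
      (volume.restrict (Ioo t₁ t₂ ×ˢ Ω)) := hug.1.1.mono_measure hle
  obtain ⟨K, hK⟩ := exists_bound_of_continuousOn hΩb hu h2
  have huK : ∀ᵐ z ∂((volume : Measure (ℝ × Coord n)).restrict (Ioo t₁ t₂ ×ˢ Ω)),
      0 ≤ u z.1 z.2 ∧ u z.1 z.2 ≤ K := by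
    filter_upwards [ae_restrict_mem hmeasQ] with z hz
    exact ⟨hu0 _ (hsub hz.1) _ hz.2, (le_abs_self _).trans
      (hK _ ⟨h1.le.trans hz.1.1.le, hz.1.2.le⟩ _ (subset_closure hz.2))⟩
  have hr0 : 0 < P.r := by linarith
  have hwi : IntegrableOn (fun z : ℝ × Coord n => w z.1 z.2) (Ioo t₁ t₂ ×ˢ Ω) :=
    (hw.1.mono_measure hle).integrable one_le_two
  have hgr : IntegrableOn (fun z : ℝ × Coord n => ‖g z.1 z.2‖ ^ P.r) (Ioo t₁ t₂ ×ˢ Ω) := by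
    have := (hug.2.1.mono_measure hle).integrable_norm_rpow (by simpa using hr0) (by simp)
    rwa [ENNReal.toReal_ofReal hr0.le] at this
  have hgp : IntegrableOn (fun z : ℝ × Coord n => ‖g z.1 z.2‖ ^ P.p) (Ioo t₁ t₂ ×ˢ Ω) := by
    have := ((hug.2.1.mono_measure hle).mono_exponent
      (ENNReal.ofReal_le_ofReal hpr.le)).integrable_norm_rpow
      (by simpa using by linarith) (by simp)
    rwa [ENNReal.toReal_ofReal (by linarith)] at this
  have i1 := integrable_mul_rpow_of_bounded hum huK (b := a) (by linarith) hwi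
  have i2 := integrable_mul_rpow_of_bounded hum huK (b := a - 1) (by linarith) hgp
  have i3 := integrable_mul_rpow_of_bounded hum huK (b := a) (by linarith) hgr
  have i4 := integrable_mul_rpow_of_bounded hum huK (b := a) (by linarith)
    (integrable_rpow_of_bounded hum huK hq.le)
  refine ⟨i1, i2, i3, i4, ?_⟩
  refine le_of_tendsto_of_tendsto'
    (tendsto_integral_timeCutoff_mul hΩ.measurableSet h1 h2 ((i4.const_mul P.α).add
      (i3.const_mul P.β)))
    (tendsto_integral_timeCutoff_mul hΩ.measurableSet h1 h2 (i1.add (i2.const_mul a)))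
    fun k => ?_
  have hk := htest _ _ (continuousOn_timeCutoff_mul_rpow (by linarith) hu h1 h12 h2 k)
    (isBochnerSobolevZero_timeCutoff_mul_rpow hΩ hΩb hp hpr.le ha hu hu0 hug h2 k)
    (fun t ht x hx => mul_nonneg (timeCutoff_nonneg _ _ _ _) (Real.rpow_nonneg (hu0 t ht x hx) _))
    (fun t ht x hx => by
      rw [le_antisymm (hfr2 t ht x hx) (hfr1 t ht x hx), Real.zero_rpow (by linarith), mul_zero])
  refine (le_of_eq ?_).trans (hk.trans (le_of_eq ?_))
  · refine setIntegral_congr_fun (measurableSet_Ioo.prod hΩ.measurableSet) fun z hz => ?_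
    simp only [abs_rpow_sub_one_mul_self (hu0 _ hz.1 _ hz.2) hq]
    ring
  · refine setIntegral_congr_fun (measurableSet_Ioo.prod hΩ.measurableSet) fun z hz => ?_
    simp only [norm_rpow_sub_two_mul_inner_smul (g z.1 z.2) _ (by linarith : 0 < P.p)]
    ring

/-- The weight `2 R b (2 R b)^{r-1}` in the Poincaré inequality `IsSobolevZero.integral_rpow_le`. -/
def poincareConst (R r b : ℝ) : ℝ := 2 * (R * b * (2 * (R * b)) ^ (r - 1))

theorem poincareConst_pos {R r b : ℝ} (hR : 0 < R) (hb : 0 < b) : 0 < poincareConst R r b := by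
  unfold poincareConst
  positivity

/-- The lower bound for the right-hand side at a fixed time. -/
theorem IsSobolevZero.le_integral_reaction {r a s R K β D : ℝ} {f : Coord n → ℝ}
    {g : Coord n → EuclideanSpace ℝ (Fin (n 0))}
    (h : G.IsSobolevZero Ω (ENNReal.ofReal r) f g) (hΩ : MeasurableSet Ω) (hΩ' : volume Ω ≠ ⊤)
    (hR0 : 0 < R) (hR : ∀ x ∈ Ω, ‖x‖ ≤ R) (hr : 1 < r) (ha : 0 < a) (hβ : 0 < β)
    (hs : 0 < s) (hsa : s < r + a)
    (hf : ∀ᵐ x ∂(volume.restrict Ω), 0 ≤ f x ∧ f x ≤ K) :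
    β / (2 * poincareConst R r (r + a)) / (volume.real Ω + 1) ^ ((r + a) / s - 1) *
        (∫ x in Ω, f x ^ s) ^ ((r + a) / s) - D * volume.real Ω ≤
      ∫ x in Ω, (3 * β / 4 * (‖g x‖ ^ r * f x ^ a) -
        β / (4 * poincareConst R r (r + a)) * f x ^ (r + a) - D) := by
  have hfin : IsFiniteMeasure (volume.restrict Ω) := ⟨by simpa using hΩ'.lt_top⟩
  have i1 : Integrable (fun x => f x ^ (r + a)) (volume.restrict Ω) :=
    integrable_rpow_of_bounded h.1.1 hf (by linarith)
  have ig : Integrable (fun x => ‖g x‖ ^ r) (volume.restrict Ω) := by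
    have := h.2.1.integrable_norm_rpow (by simpa using by linarith) (by simp)
    rwa [ENNReal.toReal_ofReal (by linarith)] at this
  have i2 : Integrable (fun x => ‖g x‖ ^ r * f x ^ a) (volume.restrict Ω) :=
    integrable_mul_rpow_of_bounded h.1.1 hf ha.le ig
  have hpo := h.integral_rpow_le hΩ hΩ' hR0 hR hr (a := r + a) (by linarith) hf
  rw [add_sub_cancel_left] at hpo
  have hC0 : 0 < poincareConst R r (r + a) := poincareConst_pos hR0 (by linarith)
  have hje := rpow_integral_le h.1.1 hf hs ((one_lt_div hs).mpr hsa)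
  rw [mul_div_cancel₀ _ hs.ne', measureReal_restrict_apply_univ] at hje
  change _ ≤ poincareConst R r (r + a) * _ at hpo
  set C := poincareConst R r (r + a) with hC
  set A := ∫ x in Ω, f x ^ (r + a) with hA
  set B := ∫ x in Ω, ‖g x‖ ^ r * f x ^ a with hB
  set W := (volume.real Ω + 1) ^ ((r + a) / s - 1) with hW
  have hW0 : 0 < W := Real.rpow_pos_of_pos (by positivity) _
  have e1 : ∫ x in Ω, (3 * β / 4 * (‖g x‖ ^ r * f x ^ a) - β / (4 * C) * f x ^ (r + a) - D) =
      3 * β / 4 * B - β / (4 * C) * A - D * volume.real Ω := by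
    have j1 : Integrable (fun x => 3 * β / 4 * (‖g x‖ ^ r * f x ^ a) -
        β / (4 * C) * f x ^ (r + a)) (volume.restrict Ω) := (i2.const_mul _).sub (i1.const_mul _)
    rw [integral_sub j1 (integrable_const D), integral_sub (i2.const_mul _) (i1.const_mul _),
      integral_const_mul, integral_const_mul, integral_const, measureReal_restrict_apply_univ,
      smul_eq_mul, mul_comm D]
  rw [e1]
  -- Since `A ≤ C * B`, the term `3 * β / 4 * B` pays for `β / (4 * C) * A` three times: once for
  -- the absorption, twice for the superlinear term.
  have e2 : β / (2 * C) / W * (∫ x in Ω, f x ^ s) ^ ((r + a) / s) ≤ β / (2 * C) * A := by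
    rw [div_mul_eq_mul_div, div_le_iff₀ hW0, mul_assoc, mul_comm A W]
    exact mul_le_mul_of_nonneg_left hje (by positivity)
  have e3 : β / (4 * C) * A ≤ β / 4 * B := by
    calc β / (4 * C) * A ≤ β / (4 * C) * (C * B) :=
          mul_le_mul_of_nonneg_left hpo (by positivity)
      _ = β / 4 * B := by field_simp
  have e4 : β / (2 * C) * A = 2 * (β / (4 * C) * A) := by
    field_simp
    ring
  linarith

/-- The integrated differential inequality for `∫ u^s`. -/
theorem IsWeakSolution.integral_superlinear_le {P : Params} {u₀ : Coord n → ℝ} {T : ℝ}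
    {u : ℝ → Coord n → ℝ} (h : G.IsWeakSolution Ω P u₀ T u) (hΩ : IsOpen Ω)
    (hΩb : Bornology.IsBounded Ω) (hp : 1 < P.p) (hpr : P.p < P.r) (hq : 0 < P.q)
    (hqr : P.q ≤ P.r) (hβ : 0 < P.β) {R K₁ K₂ a s : ℝ} (hR0 : 0 < R) (hR : ∀ x ∈ Ω, ‖x‖ ≤ R)
    (ha : a = P.r / (P.r - P.p)) (hs : s = a + 1)
    (hK₁ : ∀ X : ℝ, 0 ≤ X → a * X ^ (P.p / P.r) ≤ P.β / 4 * X + K₁)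
    (hK₂ : ∀ τ : ℝ, 0 ≤ τ → |P.α| * τ ^ (P.q + a) ≤
      P.β / (4 * poincareConst R P.r (P.r + a)) * τ ^ (P.r + a) + K₂)
    {t₁ t₂ : ℝ} (h1 : 0 < t₁) (h12 : t₁ < t₂) (h2 : t₂ < T) :
    ∫ t in t₁..t₂, (s * (P.β / (2 * poincareConst R P.r (P.r + a)) /
        (volume.real Ω + 1) ^ ((P.r + a) / s - 1)) * (∫ x in Ω, u t x ^ s) ^ ((P.r + a) / s) -
        s * ((K₁ + K₂) * volume.real Ω)) ≤
      (∫ x in Ω, u t₂ x ^ s) - ∫ x in Ω, u t₁ x ^ s := by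
  have hd : 0 < P.r - P.p := by linarith
  have hr0 : 0 < P.r := by linarith
  have ha1 : 1 < a := by
    rw [ha, one_lt_div hd]
    linarith
  have hu0 := h.1.1
  have hu := h.1.2.1
  have hΩf : volume Ω ≠ ⊤ := hΩb.measure_lt_top.ne
  obtain ⟨g, w, hug, hw, htest⟩ := h.exists_power_test hΩ hΩb hp hpr hq hqr ha1
  obtain ⟨i1, i2, i3, i4, hineq⟩ := htest t₁ t₂ h1 h12 h2
  have hfin1 : IsFiniteMeasure (volume.restrict Ω) := ⟨by simpa using hΩb.measure_lt_top⟩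
  have hfin : IsFiniteMeasure ((volume : Measure (ℝ × Coord n)).restrict (Ioo 0 T ×ˢ Ω)) := by
    rw [restrict_prod_eq]
    infer_instance
  have hfin2 : IsFiniteMeasure ((volume : Measure (ℝ × Coord n)).restrict (Ioo t₁ t₂ ×ˢ Ω)) := by
    rw [restrict_prod_eq]
    infer_instance
  have hsub : Ioo t₁ t₂ ⊆ Ioo 0 T := fun t ht => ⟨h1.trans ht.1, ht.2.trans h2⟩
  have hsubc : Icc t₁ t₂ ⊆ Ico 0 T := fun t ht => ⟨h1.le.trans ht.1, ht.2.trans_lt h2⟩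
  have hmeasQ : MeasurableSet (Ioo t₁ t₂ ×ˢ Ω) := measurableSet_Ioo.prod hΩ.measurableSet
  have hui : IntegrableOn (fun z : ℝ × Coord n => u z.1 z.2) (Ioo 0 T ×ˢ Ω) :=
    hug.1.integrable (by simpa using by linarith)
  have hwi : IntegrableOn (fun z : ℝ × Coord n => w z.1 z.2) (Ioo 0 T ×ˢ Ω) :=
    hw.1.integrable one_le_two
  have hid := hw.integral_rpow_sub hΩ hΩb hu hu0 hui hwi (s := s) (by linarith) h1 h12 h2
  rw [show s - 1 = a by linarith] at hid
  set Cp := poincareConst R P.r (P.r + a) with hCp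
  have hCp0 : 0 < Cp := poincareConst_pos hR0 (by linarith)
  obtain ⟨K, hK⟩ := exists_bound_of_continuousOn hΩb hu h2
  have hbd : ∀ t ∈ Ioo t₁ t₂, ∀ x ∈ Ω, 0 ≤ u t x ∧ u t x ≤ K := fun t ht x hx =>
    ⟨hu0 _ (hsub ht) _ hx, (le_abs_self _).trans
      (hK _ ⟨h1.le.trans ht.1.le, ht.2.le⟩ _ (subset_closure hx))⟩
  set F : ℝ × Coord n → ℝ := fun z => 3 * P.β / 4 * (‖g z.1 z.2‖ ^ P.r * u z.1 z.2 ^ a) -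
    P.β / (4 * Cp) * u z.1 z.2 ^ (P.r + a) - (K₁ + K₂) with hF
  have i5 : IntegrableOn (fun z : ℝ × Coord n => u z.1 z.2 ^ (P.r + a)) (Ioo t₁ t₂ ×ˢ Ω) := by
    refine integrable_rpow_of_bounded (hui.1.mono_set (prod_mono_left hsub)) (K := K) ?_
      (by linarith)
    filter_upwards [ae_restrict_mem hmeasQ] with z hz
    exact hbd _ hz.1 _ hz.2
  have iF : IntegrableOn F (Ioo t₁ t₂ ×ˢ Ω) :=
    ((i3.const_mul _).sub (i5.const_mul _)).sub (integrable_const _)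
  have hFle : ∫ z in Ioo t₁ t₂ ×ˢ Ω, F z ≤
      ∫ z in Ioo t₁ t₂ ×ˢ Ω, w z.1 z.2 * u z.1 z.2 ^ a := by
    have j1 : IntegrableOn (fun z : ℝ × Coord n => P.α * (u z.1 z.2 ^ P.q * u z.1 z.2 ^ a) +
        P.β * (‖g z.1 z.2‖ ^ P.r * u z.1 z.2 ^ a)) (Ioo t₁ t₂ ×ˢ Ω) :=
      (i4.const_mul _).add (i3.const_mul _)
    have e1 : ∫ z in Ioo t₁ t₂ ×ˢ Ω, F z ≤ ∫ z in Ioo t₁ t₂ ×ˢ Ω,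
        ((P.α * (u z.1 z.2 ^ P.q * u z.1 z.2 ^ a) + P.β * (‖g z.1 z.2‖ ^ P.r * u z.1 z.2 ^ a)) -
          a * (‖g z.1 z.2‖ ^ P.p * u z.1 z.2 ^ (a - 1))) := by
      refine setIntegral_mono_on iF (j1.sub (i2.const_mul a)) hmeasQ fun z hz => ?_
      have hz0 := (hbd _ hz.1 _ hz.2).1
      -- This is where `a = r / (r - p)` matters: it is equivalent to `a * (p / r) = a - 1`. With
      -- `hK₁` the diffusion term then costs one quarter of `β`, leaving the `3 * P.β / 4` in `F`.
      have f1 : ‖g z.1 z.2‖ ^ P.p * u z.1 z.2 ^ (a - 1) =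
          (‖g z.1 z.2‖ ^ P.r * u z.1 z.2 ^ a) ^ (P.p / P.r) := by
        rw [Real.mul_rpow (by positivity) (by positivity), ← Real.rpow_mul (norm_nonneg _),
          ← Real.rpow_mul hz0, mul_div_cancel₀ _ hr0.ne']
        congr 2
        rw [ha]
        field_simp
        ring
      have f2 : u z.1 z.2 ^ P.q * u z.1 z.2 ^ a = u z.1 z.2 ^ (P.q + a) :=
        (Real.rpow_add_of_nonneg hz0 hq.le (by linarith)).symm
      have f3 := hK₁ (‖g z.1 z.2‖ ^ P.r * u z.1 z.2 ^ a) (by positivity)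
      have f4 := hK₂ _ hz0
      have f5 : -(|P.α| * u z.1 z.2 ^ (P.q + a)) ≤ P.α * u z.1 z.2 ^ (P.q + a) := by
        rw [← neg_mul]
        exact mul_le_mul_of_nonneg_right (neg_abs_le _) (by positivity)
      simp only [hF]
      rw [f1, f2]
      linarith
    rw [integral_sub j1 (i2.const_mul a)] at e1
    rw [integral_add i1 (i2.const_mul a)] at hineq
    linarith
  have hs0 : 0 < s := by linarith
  have hsr : s < P.r + a := by linarith
  have hy : ContinuousOn (fun t => ∫ x in Ω, u t x ^ s) (Ico 0 T) :=
    continuousOn_setIntegral (u := fun t x => u t x ^ s) hΩ.measurableSet hΩb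
      ((Real.continuous_rpow_const hs0.le).comp_continuousOn hu)
  have iF' : Integrable F ((volume.restrict (Ioo t₁ t₂)).prod (volume.restrict Ω)) := by
    rw [← restrict_prod_eq]
    exact iF
  have hmain : ∫ t in Ioo t₁ t₂, (P.β / (2 * Cp) /
        (volume.real Ω + 1) ^ ((P.r + a) / s - 1) * (∫ x in Ω, u t x ^ s) ^ ((P.r + a) / s) -
        (K₁ + K₂) * volume.real Ω) ≤ ∫ t in Ioo t₁ t₂, ∫ x in Ω, F (t, x) := by
    refine integral_mono_ae ?_ iF'.integral_prod_left ?_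
    · refine IntegrableOn.mono_set (t := Icc t₁ t₂) ?_ Ioo_subset_Icc_self
      refine ContinuousOn.integrableOn_Icc ((continuousOn_const.mul
        ((Real.continuous_rpow_const (by positivity)).comp_continuousOn (hy.mono hsubc))).sub
          continuousOn_const)
    · filter_upwards [ae_restrict_of_ae_restrict_of_subset hsub hug.2.2,
        ae_restrict_mem measurableSet_Ioo] with t ht htm
      refine ht.le_integral_reaction hΩ.measurableSet hΩf hR0 hR (by linarith) (by linarith) hβ
        hs0 hsr (K := K) ?_
      filter_upwards [ae_restrict_mem hΩ.measurableSet] with x hx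
      exact hbd t htm x hx
  rw [← integral_Ioo_prod_eq iF] at hmain
  rw [hid, intervalIntegral.integral_of_le h12.le, integral_Ioc_eq_integral_Ioo]
  refine le_trans (le_of_eq ?_) (mul_le_mul_of_nonneg_left (hmain.trans hFle) hs0.le)
  rw [← integral_const_mul]
  refine integral_congr_ae (ae_of_all _ fun t => ?_)
  ring

end StratifiedGroup

end Energy

/-! ### Threshold on the initial data and the main theorem. -/

section Threshold

namespace StratifiedGroup

variable {σ : ℕ} {n : Fin (σ + 1) → ℕ} {G : StratifiedGroup n} {Ω : Set (Coord n)}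

theorem IsWeakSolution.lt_integral_rpow {P : Params} {u₀ : Coord n → ℝ} {T M s : ℝ}
    {u : ℝ → Coord n → ℝ} (h : G.IsWeakSolution Ω P u₀ T u) (hT : 0 < T) (hΩ : MeasurableSet Ω)
    (hΩb : Bornology.IsBounded Ω) (hs : 0 < s) (hu₀ : ∀ᵐ x ∂(volume.restrict Ω), 0 ≤ u₀ x)
    (hM : M < ∫ x in Ω, u₀ x ^ s) : M < ∫ x in Ω, u 0 x ^ s := by
  have hfin1 : IsFiniteMeasure (volume.restrict Ω) := ⟨by simpa using hΩb.measure_lt_top⟩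
  obtain ⟨K, hK⟩ := exists_bound_of_continuousOn hΩb h.1.2.1 hT
  have hge : ∀ᵐ x ∂(volume.restrict Ω), u₀ x ≤ u 0 x := h.1.2.2.1
  refine hM.trans_le (integral_mono_of_nonneg ?_ ?_ ?_)
  · filter_upwards [hu₀] with x hx
    exact Real.rpow_nonneg hx _
  · refine integrable_rpow_of_bounded (aestronglyMeasurable_slice hΩ h.1.2.1 ⟨le_rfl, hT⟩)
      (K := K) ?_ hs.le
    filter_upwards [hu₀, hge, ae_restrict_mem hΩ] with x hx hx' hxΩ
    exact ⟨hx.trans hx', (le_abs_self _).trans (hK 0 ⟨le_rfl, le_rfl⟩ x (subset_closure hxΩ))⟩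
  · filter_upwards [hu₀, hge] with x hx hx'
    exact Real.rpow_le_rpow hx hx' hs.le

/-- Large initial data lead to a finite maximal existence time as soon as the absorption term is
dominated by the Poincaré-controlled gradient term, up to a constant. -/
theorem exists_threshold_maxExistenceTime_lt_top (hΩ : IsOpen Ω) (hΩb : Bornology.IsBounded Ω)
    {P : Params} (hp : 1 < P.p) (hpr : P.p < P.r) (hq : 0 < P.q) (hqr : P.q ≤ P.r)
    (hβ : 0 < P.β) {R K₂ a : ℝ} (hR0 : 0 < R) (hR : ∀ x ∈ Ω, ‖x‖ ≤ R)
    (ha : a = P.r / (P.r - P.p)) (hK₂0 : 0 ≤ K₂)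
    (hK₂ : ∀ τ : ℝ, 0 ≤ τ → |P.α| * τ ^ (P.q + a) ≤
      P.β / (4 * poincareConst R P.r (P.r + a)) * τ ^ (P.r + a) + K₂) :
    ∃ M : ℝ, 0 < M ∧ ∀ u₀ : Coord n → ℝ, G.IsInitialDatum Ω u₀ →
      M < ∫ x in Ω, u₀ x ^ ((2 * P.r - P.p) / (P.r - P.p)) →
      G.maxExistenceTime Ω P u₀ < ⊤ := by
  have hd : 0 < P.r - P.p := by linarith
  have hr0 : 0 < P.r := by linarith
  have ha0 : 0 < a := by
    rw [ha]
    positivity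
  set s := (2 * P.r - P.p) / (P.r - P.p) with hsdef
  have hs : s = a + 1 := by
    rw [hsdef, ha]
    field_simp
    ring
  have hs0 : 0 < s := by linarith
  obtain ⟨K₁, hK₁0, hK₁⟩ := exists_forall_mul_rpow_le (θ := P.p / P.r) (A := a)
    (ε := P.β / 4) (by positivity) ((div_lt_one hr0).mpr hpr) ha0.le (by positivity)
  have hκ : 1 < (P.r + a) / s := (one_lt_div hs0).mpr (by linarith)
  set κ := (P.r + a) / s with hκdef
  have hCp : 0 < poincareConst R P.r (P.r + a) := poincareConst_pos hR0 (by linarith)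
  set c := s * (P.β / (2 * poincareConst R P.r (P.r + a)) / (volume.real Ω + 1) ^ (κ - 1)) with hc
  set C := s * ((K₁ + K₂) * volume.real Ω) with hC
  have hW : 0 < (volume.real Ω + 1) ^ (κ - 1) := Real.rpow_pos_of_pos (by positivity) _
  have hc0 : 0 < c := by positivity
  have hC0 : 0 ≤ C := by positivity
  -- Above this level half of `c * y ^ κ` already dominates `C`; the `+ 1` makes `M` positive even
  -- if `C = 0`.
  set M := (2 * C / c) ^ (1 / κ) + 1 with hM
  have hM0 : 0 < M := by positivity
  have hMC : 2 * C ≤ c * M ^ κ := by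
    have e1 : 2 * C / c ≤ M ^ κ := by
      calc 2 * C / c = ((2 * C / c) ^ (1 / κ)) ^ κ := by
            rw [← Real.rpow_mul (by positivity), one_div_mul_cancel (by linarith), Real.rpow_one]
        _ ≤ M ^ κ := Real.rpow_le_rpow (by positivity) (by linarith) (by linarith)
    rw [div_le_iff₀ hc0] at e1
    linarith
  refine ⟨M, hM0, fun u₀ hu₀ hlarge => ?_⟩
  -- This bound is independent of `T` and of the solution, so it bounds the supremum of all
  -- existence times.
  refine lt_of_le_of_lt (b := ENNReal.ofReal (2 * M ^ (1 - κ) / (c * (κ - 1)) + 1)) ?_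
    ENNReal.ofReal_lt_top
  refine sSup_le ?_
  rintro _ ⟨T, hT, rfl, u, hu⟩
  refine ENNReal.ofReal_le_ofReal ?_
  have hy : ContinuousOn (fun t => ∫ x in Ω, u t x ^ s) (Ico 0 T) :=
    continuousOn_setIntegral (u := fun t x => u t x ^ s) hΩ.measurableSet hΩb
      ((Real.continuous_rpow_const hs0.le).comp_continuousOn hu.1.2.1)
  exact le_of_superlinear hc0 hκ hM0 hMC hC0 hT hy
    (hu.lt_integral_rpow hT hΩ.measurableSet hΩb hs0 hu₀.2.1 hlarge)
    fun t₁ t₂ h1 h12 h2 => hu.integral_superlinear_le hΩ hΩb hp hpr hq hqr hβ hR0 hR ha hs hK₁ hK₂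
      h1 h12 h2

end StratifiedGroup

end Threshold

end

theorem mainTheorem4 {σ : ℕ} {n : Fin (σ + 1) → ℕ} (G : StratifiedGroup n)
    (Ω : Set (Coord n)) (hΩ : IsOpen Ω) (hΩb : Bornology.IsBounded Ω)
    (p r : ℝ) (hp : 1 < p) (hr : 1 < r) :
    (∀ q α β : ℝ, 0 < q → α < 0 → 0 < β → max p q < r →
      ∃ M : ℝ, 0 < M ∧ ∀ u₀ : Coord n → ℝ, G.IsInitialDatum Ω u₀ →
        M < ∫ x in Ω, u₀ x ^ ((2 * r - p) / (r - p)) →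
        G.maxExistenceTime Ω ⟨α, β, p, q, r⟩ u₀ < ⊤) ∧
    (∀ q : ℝ, r = q → p < q →
      ∃ Λ : ℝ, 0 < Λ ∧ ∀ α β : ℝ, α < 0 → 0 < β → Λ * |α| ≤ β →
        ∃ M : ℝ, 0 < M ∧ ∀ u₀ : Coord n → ℝ, G.IsInitialDatum Ω u₀ →
          M < ∫ x in Ω, u₀ x ^ ((2 * r - p) / (r - p)) →
          G.maxExistenceTime Ω ⟨α, β, p, q, r⟩ u₀ < ⊤) := by
  obtain ⟨R, hR0, hR⟩ := hΩb.exists_pos_norm_le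
  have hr0 : 0 < r := by linarith
  constructor
  · intro q α β hq _ hβ hmax
    have hpr : p < r := (le_max_left _ _).trans_lt hmax
    have hqr : q < r := (le_max_right _ _).trans_lt hmax
    have hd : 0 < r - p := by linarith
    have ha0 : 0 < r / (r - p) := by positivity
    have hCp : 0 < StratifiedGroup.poincareConst R r (r + r / (r - p)) :=
      StratifiedGroup.poincareConst_pos hR0 (by positivity)
    -- Young's inequality in the variable `X = τ ^ (r + a)`; the exponent is below `1` because `q <
    -- r`.
    obtain ⟨K₂, hK₂0, hK₂⟩ := exists_forall_mul_rpow_le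
      (θ := (q + r / (r - p)) / (r + r / (r - p))) (A := |α|)
      (ε := β / (4 * StratifiedGroup.poincareConst R r (r + r / (r - p)))) (by positivity)
      ((div_lt_one (by positivity)).mpr (by linarith)) (abs_nonneg α) (by positivity)
    refine G.exists_threshold_maxExistenceTime_lt_top (P := ⟨α, β, p, q, r⟩) hΩ hΩb hp hpr hq
      hqr.le hβ hR0 hR rfl hK₂0 fun τ hτ => ?_
    have h := hK₂ (τ ^ (r + r / (r - p))) (by positivity)
    rwa [← Real.rpow_mul hτ, mul_div_cancel₀ _ (by positivity)] at h
  · rintro q rfl hpr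
    have hd : 0 < r - p := by linarith
    have hCp : 0 < StratifiedGroup.poincareConst R r (r + r / (r - p)) :=
      StratifiedGroup.poincareConst_pos hR0 (by positivity)
    -- For `q = r` both powers of `τ` coincide, and this `Λ` gives exactly `|α| ≤ β / (4 * C)` with
    -- `C` the Poincaré constant, so `K₂ = 0` is possible.
    refine ⟨4 * StratifiedGroup.poincareConst R r (r + r / (r - p)), by positivity,
      fun α β _ hβ hΛ => ?_⟩
    refine G.exists_threshold_maxExistenceTime_lt_top (P := ⟨α, β, p, r, r⟩) hΩ hΩb hp hpr hr0
      le_rfl hβ hR0 hR rfl le_rfl fun τ hτ => ?_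
    rw [add_zero]
    refine mul_le_mul_of_nonneg_right ?_ (by positivity)
    rw [le_div_iff₀ (by positivity), mul_comm]
    exact hΛ
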